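/- Let $n\ge 0$, let $t,z\in\mathbb C$, and let $x_1,\dots,x_n,y_1,\dots,y_n\in\mathbb C\setminus\{0\}$ with $x_i^2\ne t$ and $y_i^2\ne t$ for all $i$. Write $\bar u=1/u$, and assume that $|z\,x_i^{\epsilon}y_j^{\eta}|<1$ for all $i,j$ and all $\epsilon,\eta\in\{\pm1\}$. **Partitions.** A partition $\lambda=(\lambda_1\ge\dots\ge\lambda_n\ge0)$ has exactly $n$ parts, zeros allowed; $|\lambda|=\sum_i\lambda_i$, $m_j(\lambda)=\#\{k:\lambda_k=j\}$ for $j\ge0$, and $b_\lambda(t)=\prod_{j\ge1}\prod_{i=1}^{m_j(\lambda)}(1-t^i)$. **Hall–Littlewood polynomials of type $BC_n$.** Let $V$ have the basis of states $|m\rangle=\bigotimes_{i\ge0}|m_i\rangle_i$, where $m_i\ge0$ and only finitely many $m_i$ are non-zero; put $|\lambda\rangle=\bigotimes_i|m_i(\lambda)\rangle_i$ and let $|0\rangle$ be the empty state. On the $i$-th factor let $\phi|m\rangle=(1-t^m)|m-1\rangle$ and $\phi^\dagger|m\rangle=|m+1\rangle$, and let $L(x)=\begin{pmatrix}x&x\phi^\dagger\\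 \phi&1\end{pmatrix}$, whose rows (columns) are indexed by the state hole, particle of the left (right) edge of a tile. For an edge state $a$ let $T_{a}(x)$ be the row $a$, column "particle" entry of the product $\prod_{i\ge0}L(x,\phi_i,\phi_i^\dagger)$, where only those configurations are kept in which all edges sufficiently far to the right are particles. Let $$\mathbb T_{--}(x)=T_{\rm particle}(\bar x)\,T_{\rm hole}(x)-t\,T_{\rm hole}(\bar x)\,T_{\rm particle}(x).$$ The $BC_n$ Hall–Littlewood polynomial $K_\lambda$ (with vanishing boundary parameters) is defined by $$\prod_{i=1}^n(x_i-t\bar x_i)\,K_\lambda(x_1^{\pm1},\dots,x_n^{\pm1};t)=\langle\lambda|\,\mathbb T_{--}(x_n)\cdots\mathbb T_{--}(x_1)\,|0\rangle .$$ **The partition function $Z_{\rm UU}$.** Consider a $2n\times2n$ square lattice whose rows carry, from top to bottom, the spectral parameters $zx_1,z\bar x_1,\dots,zx_n,z\bar x_n$, and whose columns carry, from right to left, the spectral parameters $y_1,\bar y_1,\dots,y_n,\bar y_n$. Every edge is a hole ($0$) or a particle ($1$). A vertex in a row with parameter $u$ and a column with parameter $w$ has, with $q=u/w$ and edge states (left,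 right; bottom, top), the weight $$(0,0;0,0),(1,1;1,1):\ \tfrac{1-tq}{1-q},\quad (0,0;1,1):\ t,\quad(1,1;0,0):\ 1,\quad(0,1;1,0):\ \tfrac{(1-t)q}{1-q},\quad(1,0;0,1):\ \tfrac{1-t}{1-q},$$ and weight $0$ otherwise. All edges at the right end are particles and all edges at the top are holes. For each $i$ the left ends of the rows $zx_i$ and $z\bar x_i$ are joined by a U-turn of weight $1$ if their states are $(0,1)$, weight $-t$ if they are $(1,0)$, and weight $0$ otherwise; for each $j$ the lower ends of the columns $\bar y_j$ and $y_j$ (in this order) are joined by a U-turn with the same weights. $Z_{\rm UU}$ is the sum over all configurations of the product of all vertex and U-turn weights. **Theorem (doubly reflecting Cauchy identity).** The series below, over all partitions $\lambda$ with $n$ parts, converges absolutely, and $$\prod_{j=1}^n(x_j-t\bar x_j)(\bar y_j-ty_j)\ \sum_{\lambda}z^{n+|\lambda|}\prod_{i=1}^{m_0(\lambda)}(1-t^i)\;b_\lambda(t)\,K_\lambda(x_1^{\pm1},\dots,x_n^{\pm1};t)\,K_\lambda(y_1^{\pm1},\dots,y_n^{\pm1};t)=Z_{\rm UU}(x_1^{\pm1},\dots,x_n^{\pm1};y_1^{\pm1},\dots,y_n^{\pm1};t;z).$$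 -/

import Mathlib

open Filter

noncomputable section

namespace DoublyReflecting

/-! Edge states are Booleans: `true` is a particle, `false` is a hole.
A basis state of the physical space is a finitely supported family of occupation
numbers `m 0, m 1, m 2, …`. -/

/-- Boltzmann weight of a tile of the `t`-boson model, i.e. the entry of
`L(x) = [[x, x φ†], [φ, 1]]` with the given left and right edge states, between the
occupation number `bot` below and `top` above the tile, where
`φ |m⟩ = (1 - t ^ m) |m - 1⟩` and `φ† |m⟩ = |m + 1⟩` act from top to bottom. -/
def tileWeight (t x : ℂ) (bot : ℕ) (left right : Bool) (top : ℕ) : ℂ :=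
  match left, right with
  | false, false => if bot = top then x else 0
  | false, true => if bot = top + 1 then x else 0
  | true, false => if bot + 1 = top then 1 - t ^ top else 0
  | true, true => if bot = top then 1 else 0

/-- Matrix element `⟨bot| T(x) |top⟩` of an infinite row of tiles (columns `0, 1, 2, …`)
with left edge state `a`, and with particles on all horizontal edges sufficiently far to
the right. Here `e i` is the state of the edge on the left of column `i`. -/
def rowElem (t x : ℂ) (a : Bool) (bot top : ℕ →₀ ℕ) : ℂ :=
  ∑ᶠ (e : ℕ → Bool) (_ : e 0 = a ∧ ∀ᶠ i in atTop, e i = true),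
    ∏ᶠ i : ℕ, tileWeight t x (bot i) (e i) (e (i + 1)) (top i)

/-- Components of the boundary covector `(1 0) ⊗ (0 1) - t (0 1) ⊗ (1 0)`. -/
def uTurn (t : ℂ) (first second : Bool) : ℂ :=
  match first, second with
  | false, true => 1
  | true, false => -t
  | _, _ => 0

/-- Matrix element `⟨bot| 𝕋₋₋(x) |top⟩` of the double-row transfer matrix: a row with
spectral parameter `x` above a row with spectral parameter `x⁻¹`, joined by a U-turn at
their left ends, and all edges occupied by particles far to the right. -/
def doubleRowElem (t x : ℂ) (bot top : ℕ →₀ ℕ) : ℂ :=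
  ∑ a : Bool, ∑ b : Bool, uTurn t a b *
    ∑ᶠ mid : ℕ →₀ ℕ, rowElem t x⁻¹ b bot mid * rowElem t x a mid top

/-- The matrix element `⟨bot| 𝕋₋₋(x_n) ⋯ 𝕋₋₋(x_1) |0⟩`. -/
def latticeElem (t : ℂ) : (n : ℕ) → (Fin n → ℂ) → (ℕ →₀ ℕ) → ℂ
  | 0, _, bot => if bot = 0 then 1 else 0
  | n + 1, x, bot =>
      ∑ᶠ mid : ℕ →₀ ℕ, doubleRowElem t (x (Fin.last n)) bot mid *
        latticeElem t n (fun i => x i.castSucc) mid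

/-- The multiplicity `m_j(lam)` of the part `j` in `lam`; parts equal to zero count. -/
def partMult {n : ℕ} (lam : Fin n → ℕ) (j : ℕ) : ℕ :=
  (Finset.univ.filter fun k => lam k = j).card

/-- The state `|lam⟩ = |m_0(lam)⟩ ⊗ |m_1(lam)⟩ ⊗ ⋯`. -/
def partState {n : ℕ} (lam : Fin n → ℕ) : ℕ →₀ ℕ :=
  Finsupp.onFinset (Finset.univ.image lam) (partMult lam) (by
    intro j hj
    obtain ⟨k, hk⟩ := Finset.card_pos.mp (Nat.pos_of_ne_zero hj)
    exact Finset.mem_image.mpr ⟨k, Finset.mem_univ k, (Finset.mem_filter.mp hk).2⟩)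

/-- `∏_{i=1}^{m_0(lam)} (1 - t ^ i)`. -/
def zeroPartFactor {n : ℕ} (t : ℂ) (lam : Fin n → ℕ) : ℂ :=
  ∏ i ∈ Finset.Icc 1 (partMult lam 0), (1 - t ^ i)

/-- `b_lam(t) = ∏_{j ≥ 1} ∏_{i=1}^{m_j(lam)} (1 - t ^ i)`; only the `j` that occur as parts
contribute. -/
def bFactor {n : ℕ} (t : ℂ) (lam : Fin n → ℕ) : ℂ :=
  ∏ j ∈ (Finset.univ.image lam).filter (fun j => 1 ≤ j),
    ∏ i ∈ Finset.Icc 1 (partMult lam j), (1 - t ^ i)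

/-- The `BC_n` Hall–Littlewood polynomial `K_lam(x_1^{±1}, …, x_n^{±1}; t)` (with both
boundary parameters zero), evaluated at a point with `x_i ≠ 0`, `x_i ^ 2 ≠ t`. -/
def hallLittlewoodBC {n : ℕ} (t : ℂ) (x : Fin n → ℂ) (lam : Fin n → ℕ) : ℂ :=
  latticeElem t n x (partState lam) / ∏ i, (x i - t * (x i)⁻¹)

/-- Weight of a vertex of the six-vertex model, i.e. an entry of its `R` matrix; `q` is
the ratio of the horizontal by the vertical spectral parameter. -/
def vertexWeight (t q : ℂ) (left right bot top : Bool) : ℂ :=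
  match left, right, bot, top with
  | false, false, false, false => (1 - t * q) / (1 - q)
  | true, true, true, true => (1 - t * q) / (1 - q)
  | false, false, true, true => t
  | true, true, false, false => 1
  | false, true, true, false => (1 - t) * q / (1 - q)
  | true, false, false, true => (1 - t) / (1 - q)
  | _, _, _, _ => 0

/-- The list `u_1, u_1⁻¹, …, u_n, u_n⁻¹`. -/
def doubled {n : ℕ} (u : Fin n → ℂ) (r : Fin (n * 2)) : ℂ :=
  if r.modNat = 0 then u r.divNat else (u r.divNat)⁻¹

/-- The partition function of the six-vertex model on a `2n × 2n` square lattice with two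
U-turn boundaries. Rows are numbered from top to bottom, with spectral parameters
`z x_1, z x_1⁻¹, …, z x_n, z x_n⁻¹`; columns are numbered from right to left, with
spectral parameters `y_1, y_1⁻¹, …, y_n, y_n⁻¹`.
`h r c` is the state of the horizontal edge of row `r` on the right of column `c`, and
`h r (last)` is the leftmost edge; `v r c` is the state of the vertical edge of column `c`
above row `r`, and `v (last) c` is the lowest edge. Right edges are particles, top edges
are holes; the left ends of rows `z x_i` (upper) and `z x_i⁻¹` (lower), and the lower ends
of columns `y_j⁻¹` (left) and `y_j` (right), are joined by U-turns. -/
def ZUU {n : ℕ} (t z : ℂ) (x y : Fin n → ℂ) : ℂ :=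
  ∑ h : Fin (n * 2) → Fin (n * 2 + 1) → Bool, ∑ v : Fin (n * 2 + 1) → Fin (n * 2) → Bool,
    if (∀ r, h r 0 = true) ∧ (∀ c, v 0 c = false) then
      (∏ r, ∏ c, vertexWeight t (z * doubled x r / doubled y c)
        (h r c.succ) (h r c.castSucc) (v r.succ c) (v r.castSucc c)) *
      (∏ i : Fin n, uTurn t (h (finProdFinEquiv (i, 0)) (Fin.last _))
        (h (finProdFinEquiv (i, 1)) (Fin.last _))) *
      (∏ j : Fin n, uTurn t (v (Fin.last _) (finProdFinEquiv (j, 1)))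
        (v (Fin.last _) (finProdFinEquiv (j, 0))))
    else 0

end DoublyReflecting

end

noncomputable section

namespace DoublyReflecting

/-! ### One site of the boson lattice -/

/-- The entry of `L(x)` acting on functions of the occupation number. -/
def tileOp (t x : ℂ) : Bool → Bool → (ℕ → ℂ) → ℕ → ℂ
  | false, false, f, m => x * f m
  | false, true, _, 0 => 0
  | false, true, f, m + 1 => x * f m
  | true, false, f, m => (1 - t ^ (m + 1)) * f (m + 1)
  | true, true, f, m => f m

/-- The entry of the adjoint of `L(x)` with respect to the form
`⟨m|m⟩ = ∏_{i=1}^m (1 - t ^ i)`. -/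
def dualTileOp (t x : ℂ) (a c : Bool) : (ℕ → ℂ) →ₗ[ℂ] (ℕ → ℂ) where
  toFun f m := match a, c, m with
    | false, false, m => x * f m
    | false, true, m => x * (1 - t ^ (m + 1)) * f (m + 1)
    | true, false, 0 => 0
    | true, false, m + 1 => f m
    | true, true, m => f m
  map_add' f g := by
    funext m
    cases a <;> cases c <;> cases m <;> simp <;> ring
  map_smul' r f := by
    funext m
    cases a <;> cases c <;> cases m <;> simp <;> ring

/-- Vertex weight with the vertical states read from the dual rows. -/
def crossWeight (t q : ℂ) (a c b d : Bool) : ℂ := vertexWeight t q a c (!b) (!d)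

/-- The numerator of `crossWeight` over the denominator `1 - q`. -/
def crossNumerator (t q : ℂ) (a c b d : Bool) : ℂ :=
  match a, c, b, d with
  | false, false, true, true => 1 - t * q
  | true, true, false, false => 1 - t * q
  | false, false, false, false => t * (1 - q)
  | true, true, true, true => 1 - q
  | false, true, false, true => (1 - t) * q
  | true, false, true, false => 1 - t
  | _, _, _, _ => 0

theorem crossWeight_eq (t q : ℂ) (hq : q ≠ 1) (a c b d : Bool) :
    crossWeight t q a c b d = (1 - q)⁻¹ * crossNumerator t q a c b d := by
  have h : 1 - q ≠ 0 := sub_ne_zero.mpr (Ne.symm hq)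
  cases a <;> cases b <;> cases c <;> cases d <;>
    simp [crossWeight, vertexWeight, crossNumerator, div_eq_inv_mul, h] <;> field_simp

theorem dualTileOp_tileOp_exchange (t u v : ℂ) (huv : u * v ≠ 1) (a b c d : Bool) (f : ℕ → ℂ) :
    ∑ γ, ∑ ε, crossWeight t (u * v) γ c ε d • dualTileOp t v b ε (tileOp t u a γ f) =
      ∑ γ, ∑ ε, crossWeight t (u * v) a γ b ε • tileOp t u γ c (dualTileOp t v ε d f) := by
  simp_rw [crossWeight_eq t _ huv, mul_smul, ← Finset.smul_sum]
  congr 1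
  funext m
  rcases m with _ | _ | m <;> cases a <;> cases b <;> cases c <;> cases d <;>
    simp only [Fintype.sum_bool, Pi.add_apply, Pi.smul_apply, smul_eq_mul, crossNumerator, tileOp,
      dualTileOp, LinearMap.coe_mk, AddHom.coe_mk] <;> ring

/-- The covector `⟨0| L*(v_1) ⋯ L*(v_M)` with prescribed edge states. -/
def dualColumn (t : ℂ) : (M : ℕ) → (Fin M → ℂ) → (Fin M → Bool) → (Fin M → Bool) →
    (ℕ → ℂ) →ₗ[ℂ] ℂ
  | 0, _, _, _ => LinearMap.proj 0
  | M + 1, v, b, d =>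
      (dualColumn t M (fun i => v i.castSucc) (fun i => b i.castSucc) fun i => d i.castSucc) ∘ₗ
        dualTileOp t (v (Fin.last M)) (b (Fin.last M)) (d (Fin.last M))

/-- The vector `L(u_N) ⋯ L(u_1) |k⟩` with prescribed edge states. -/
def siteColumn (t : ℂ) (k : ℕ) : (N : ℕ) → (Fin N → ℂ) → (Fin N → Bool) → (Fin N → Bool) → ℕ → ℂ
  | 0, _, _, _ => fun m => if m = k then 1 else 0
  | N + 1, u, a, c =>
      tileOp t (u (Fin.last N)) (a (Fin.last N)) (c (Fin.last N))
        (siteColumn t k N (fun i => u i.castSucc) (fun i => a i.castSucc) fun i => c i.castSucc)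

/-- Sum over paths of length `N` from `s₀` of the products of the given step weights. -/
def pathSum {S : Type*} [Fintype S] [DecidableEq S] (s₀ : S) :
    (N : ℕ) → (Fin N → S → S → ℂ) → S → ℂ
  | 0, _, s => if s = s₀ then 1 else 0
  | N + 1, K, s => ∑ s', K (Fin.last N) s s' * pathSum s₀ N (fun i => K i.castSucc) s'

theorem sum_snoc {S A : Type*} [Fintype S] [AddCommMonoid A] (N : ℕ)
    (F : (Fin (N + 1) → S) → A) :
    ∑ f, F f = ∑ f : Fin N → S, ∑ s : S, F (Fin.snoc f s : Fin (N + 1) → S) := by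
  rw [← (Fin.snocEquiv fun _ : Fin (N + 1) => S).sum_comp, Fintype.sum_prod_type_right]
  rfl

theorem sum_path {S : Type*} [Fintype S] [DecidableEq S] (s₀ s : S) (N : ℕ)
    (K : Fin N → S → S → ℂ) :
    ∑ p : Fin (N + 1) → S, (if p 0 = s₀ ∧ p (Fin.last N) = s then
      ∏ i : Fin N, K i (p i.succ) (p i.castSucc) else 0) = pathSum s₀ N K s := by
  induction N generalizing s with
  | zero =>
    rw [← (Equiv.funUnique (Fin 1) S).symm.sum_comp, Finset.sum_eq_single s] <;>
      simp [pathSum, Equiv.funUnique, Fin.last]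
    intro b h1 h2 h3
    exact h1 h3
  | succ N ih =>
    have key (s' : S) : (∑ p : Fin (N + 1) → S, if p 0 = s₀ ∧ p (Fin.last N) = s' then
        ∏ i : Fin N, K i.castSucc (p i.succ) (p i.castSucc) else 0) =
          pathSum s₀ N (fun i => K i.castSucc) s' := ih s' _
    rw [sum_snoc]
    simp only [pathSum, ← key, Finset.mul_sum]
    conv_rhs => rw [Finset.sum_comm]
    refine Finset.sum_congr rfl fun p _ => ?_
    rw [Finset.sum_eq_single s _ (by simp), Finset.sum_eq_single (p (Fin.last N)) _ (by simp)]
    · have h0 : (Fin.snoc p s : Fin (N + 1 + 1) → S) 0 = p 0 := by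
        rw [← Fin.castSucc_zero, Fin.snoc_castSucc]
      simp only [h0, Fin.snoc_last, and_true, Fin.prod_univ_castSucc, Fin.snoc_castSucc,
        ← Fin.castSucc_succ, Fin.succ_last, mul_ite, mul_zero]
      split_ifs <;> ring
    · intro s' _ h
      rw [if_neg (fun h' => h h'.2.symm), mul_zero]
    · intro s' _ h
      rw [if_neg]
      simp [h]

/-- One horizontal line of the six-vertex model with a particle at its right end; the vertical
states are those of the dual rows. -/
def crossRow (t u : ℂ) {M : ℕ} (v : Fin M → ℂ) (a : Bool) (b d : Fin M → Bool) : ℂ :=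
  pathSum true M (fun i l r => crossWeight t (u * v i) l r (b i) (d i)) a

theorem sum_dualColumn_tileOp (t u : ℂ) (M : ℕ) (v : Fin M → ℂ) (huv : ∀ i, u * v i ≠ 1)
    (a : Bool) (b d : Fin M → Bool) (f : ℕ → ℂ) :
    ∑ γ, ∑ ε, dualColumn t M v b ε (tileOp t u a γ f) * crossRow t u v γ ε d =
      ∑ ε, crossRow t u v a b ε * dualColumn t M v ε d f := by
  induction M generalizing a f with
  | zero => cases a <;> simp [crossRow, pathSum, dualColumn, tileOp]
  | succ M ih =>
    set v' : Fin M → ℂ := fun i => v i.castSucc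
    set b' : Fin M → Bool := fun i => b i.castSucc
    set d' : Fin M → Bool := fun i => d i.castSucc
    set w := v (Fin.last M)
    set β := b (Fin.last M)
    set δ := d (Fin.last M)
    have hH (x : Bool) (ε : Fin M → Bool) (g : ℕ → ℂ) :
        dualColumn t (M + 1) v b (Fin.snoc ε x : Fin (M + 1) → Bool) g =
          dualColumn t M v' b' ε (dualTileOp t w β x g) := by
      simp [dualColumn, v', b', w, β]
    have hH' (x : Bool) (ε : Fin M → Bool) (g : ℕ → ℂ) :
        dualColumn t (M + 1) v (Fin.snoc ε x : Fin (M + 1) → Bool) d g =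
          dualColumn t M v' ε d' (dualTileOp t w x δ g) := by
      simp [dualColumn, v', d', w, δ]
    have hR (x γ : Bool) (ε : Fin M → Bool) :
        crossRow t u v γ (Fin.snoc ε x : Fin (M + 1) → Bool) d =
          ∑ κ, crossWeight t (u * w) γ κ x δ * crossRow t u v' κ ε d' := by
      simp [crossRow, pathSum, v', d', w, δ]
    have hR' (x γ : Bool) (ε : Fin M → Bool) :
        crossRow t u v γ b (Fin.snoc ε x : Fin (M + 1) → Bool) =
          ∑ κ, crossWeight t (u * w) γ κ β x * crossRow t u v' κ b' ε := by
      simp [crossRow, pathSum, v', b', w, β]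
    have ih' := fun a f => ih v' (fun i => huv i.castSucc) a b' d' f
    have ex (κ : Bool) (ε : Fin M → Bool) := congrArg (dualColumn t M v' b' ε)
      (dualTileOp_tileOp_exchange t u w (huv (Fin.last M)) a β κ δ f)
    simp only [map_sum, map_smul, smul_eq_mul] at ex
    simp only [sum_snoc, hH, hH', hR, hR']
    calc _ = ∑ κ, ∑ ε, (∑ γ, ∑ x, crossWeight t (u * w) γ κ x δ *
            dualColumn t M v' b' ε (dualTileOp t w β x (tileOp t u a γ f))) *
              crossRow t u v' κ ε d' := by
          simp only [Fintype.sum_bool, ← Finset.sum_add_distrib]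
          exact Finset.sum_congr rfl fun _ _ => by ring
      _ = ∑ κ, ∑ x, crossWeight t (u * w) a κ β x * ∑ γ, ∑ ε,
            dualColumn t M v' b' ε (tileOp t u κ γ (dualTileOp t w x δ f)) *
              crossRow t u v' γ ε d' := by
          simp only [ex]
          simp only [Fintype.sum_bool, ← Finset.sum_add_distrib, Finset.mul_sum]
          exact Finset.sum_congr rfl fun _ _ => by ring
      _ = _ := by
          simp only [ih', Fintype.sum_bool, ← Finset.sum_add_distrib, Finset.mul_sum]
          exact Finset.sum_congr rfl fun _ _ => by ring

/-- The six-vertex partition function with holes on top and particles on the right. -/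
def crossGrid (t : ℂ) {N M : ℕ} (u : Fin N → ℂ) (v : Fin M → ℂ) (a : Fin N → Bool)
    (b : Fin M → Bool) : ℂ :=
  pathSum (fun _ => true) N (fun i b d => crossRow t (u i) v (a i) b d) b

theorem dualColumn_vacuum (t : ℂ) (M : ℕ) (v : Fin M → ℂ) (b : Fin M → Bool) :
    dualColumn t M v b (fun _ => true) (fun m => if m = 0 then 1 else 0) =
      if b = fun _ => true then 1 else 0 := by
  induction M with
  | zero => simp [dualColumn, Subsingleton.elim b fun _ => true]
  | succ M ih =>
    simp only [dualColumn, LinearMap.comp_apply]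
    rcases hb : b (Fin.last M)
    · have h0 : dualTileOp t (v (Fin.last M)) false true (fun m => if m = 0 then 1 else 0) = 0 := by
        funext m
        simp [dualTileOp]
      rw [h0, map_zero, if_neg]
      rintro rfl
      simp at hb
    · have h1 (f : ℕ → ℂ) : dualTileOp t (v (Fin.last M)) true true f = f := rfl
      rw [h1, ih]
      congr 1
      simp only [funext_iff, Fin.forall_fin_succ', hb, and_true]

theorem sum_dualColumn_siteColumn (t : ℂ) {M : ℕ} (v : Fin M → ℂ) (N : ℕ) (u : Fin N → ℂ)
    (huv : ∀ i j, u i * v j ≠ 1) (a : Fin N → Bool) (b : Fin M → Bool) :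
    ∑ c, ∑ d, dualColumn t M v b d (siteColumn t 0 N u a c) * crossGrid t u v c d =
      crossGrid t u v a b := by
  induction N generalizing b with
  | zero =>
    simp only [siteColumn, crossGrid, pathSum, mul_ite, mul_one, mul_zero, Finset.sum_ite_eq',
      Finset.mem_univ, if_true, dualColumn_vacuum]
    simp
  | succ N ih =>
    have hg (c : Fin N → Bool) (x : Bool) : siteColumn t 0 (N + 1) u a (Fin.snoc c x) =
        tileOp t (u (Fin.last N)) (a (Fin.last N)) x
          (siteColumn t 0 N (fun i => u i.castSucc) (fun i => a i.castSucc) c) := by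
      simp [siteColumn]
    have hZ (c : Fin N → Bool) (x : Bool) (d : Fin M → Bool) :
        crossGrid t u v (Fin.snoc c x : Fin (N + 1) → Bool) d =
          ∑ d', crossRow t (u (Fin.last N)) v x d d' *
            crossGrid t (fun i => u i.castSucc) v c d' := by
      simp [crossGrid, pathSum]
    have hZ' : crossGrid t u v a b =
        ∑ d', crossRow t (u (Fin.last N)) v (a (Fin.last N)) b d' *
          crossGrid t (fun i => u i.castSucc) v (fun i => a i.castSucc) d' := rfl
    simp only [sum_snoc, hg, hZ, hZ']
    calc _ = ∑ c : Fin N → Bool, ∑ d', (∑ x, ∑ d, dualColumn t M v b d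
            (tileOp t (u (Fin.last N)) (a (Fin.last N)) x
              (siteColumn t 0 N (fun i => u i.castSucc) (fun i => a i.castSucc) c)) *
            crossRow t (u (Fin.last N)) v x d d') *
              crossGrid t (fun i => u i.castSucc) v c d' := by
          refine Finset.sum_congr rfl fun c _ => ?_
          simp only [Finset.sum_mul, Finset.mul_sum, mul_assoc]
          conv_rhs => rw [Finset.sum_comm]
          refine Finset.sum_congr rfl fun x _ => ?_
          conv_rhs => rw [Finset.sum_comm]
      _ = ∑ d', crossRow t (u (Fin.last N)) v (a (Fin.last N)) b d' * ∑ c, ∑ d,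
            dualColumn t M v d' d
              (siteColumn t 0 N (fun i => u i.castSucc) (fun i => a i.castSucc) c) *
              crossGrid t (fun i => u i.castSucc) v c d := by
          simp only [sum_dualColumn_tileOp t _ M v (huv (Fin.last N)), Finset.sum_mul,
            Finset.mul_sum, mul_assoc]
          conv_rhs => rw [Finset.sum_comm]
          refine Finset.sum_congr rfl fun c _ => ?_
          conv_rhs => rw [Finset.sum_comm]
      _ = _ := by
          simp only [ih _ (fun i => huv i.castSucc)]

/-- `∏_{i=1}^m (1 - t ^ i)`, the squared norm of `|m⟩`. -/
def levelNorm (t : ℂ) (m : ℕ) : ℂ := ∏ i ∈ Finset.Icc 1 m, (1 - t ^ i)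

theorem levelNorm_succ (t : ℂ) (m : ℕ) :
    levelNorm t (m + 1) = levelNorm t m * (1 - t ^ (m + 1)) := by
  simp [levelNorm, Finset.prod_Icc_succ_top]

/-- Number of holes on a single edge. -/
def edgeHole (a : Bool) : ℕ := if a then 0 else 1

theorem exists_of_tileOp_ne_zero {t x : ℂ} {a c : Bool} {f : ℕ → ℂ} {m : ℕ}
    (h : tileOp t x a c f m ≠ 0) : ∃ k, f k ≠ 0 ∧ m + edgeHole c = k + edgeHole a := by
  cases a <;> cases c <;> rcases m with _ | m <;> simp [tileOp, edgeHole] at h ⊢ <;>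
    first | exact h.2 | exact h

/-- Number of holes of a sequence of edges. -/
def holes {N : ℕ} (a : Fin N → Bool) : ℕ := ∑ i, edgeHole (a i)

theorem holes_succ {N : ℕ} (a : Fin (N + 1) → Bool) :
    holes a = holes (fun i => a i.castSucc) + edgeHole (a (Fin.last N)) :=
  Fin.sum_univ_castSucc _

/-- Sum of the numbers of holes of the initial segments of a sequence of edges. -/
def holeRank : (N : ℕ) → (Fin N → Bool) → ℕ
  | 0, _ => 0
  | N + 1, a => holeRank N (fun i => a i.castSucc) + holes a

theorem siteColumn_conservation {t : ℂ} {k N : ℕ} {u : Fin N → ℂ} {a c : Fin N → Bool} {m : ℕ}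
    (h : siteColumn t k N u a c m ≠ 0) : m + holes c = k + holes a := by
  induction N generalizing m with
  | zero =>
    simp [siteColumn] at h
    simp [h, holes]
  | succ N ih =>
    obtain ⟨m', h', e⟩ := exists_of_tileOp_ne_zero h
    have := ih h'
    rw [holes_succ, holes_succ]
    omega

theorem siteColumn_triangular {t : ℂ} {N : ℕ} {u : Fin N → ℂ} {a c : Fin N → Bool} {m : ℕ}
    (h : siteColumn t 0 N u a c m ≠ 0) :
    holeRank N c ≤ holeRank N a ∧ (holeRank N c = holeRank N a → c = a) := by
  induction N generalizing m with
  | zero => exact ⟨le_rfl, fun _ => Subsingleton.elim _ _⟩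
  | succ N ih =>
    obtain ⟨m', h', e⟩ := exists_of_tileOp_ne_zero h
    obtain ⟨h1, h2⟩ := ih h'
    have h3 := siteColumn_conservation h
    have h4 := siteColumn_conservation h'
    simp only [holeRank]
    refine ⟨by omega, fun h5 => ?_⟩
    have h6 := h2 (by omega)
    have h7 : edgeHole (c (Fin.last N)) = edgeHole (a (Fin.last N)) := by
      have := holes_succ a
      have := holes_succ c
      rw [h6] at this
      omega
    ext i
    refine Fin.lastCases ?_ (fun i => ?_) i
    · revert h7
      cases c (Fin.last N) <;> cases a (Fin.last N) <;> simp [edgeHole]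
    · exact congrFun h6 i

theorem siteColumn_self (t : ℂ) {N : ℕ} (u : Fin N → ℂ) (a : Fin N → Bool) (m : ℕ) :
    siteColumn t 0 N u a a m = if m = 0 then ∏ i, (if a i then 1 else u i) else 0 := by
  induction N generalizing m with
  | zero => simp [siteColumn]
  | succ N ih =>
    simp only [siteColumn, Fin.prod_univ_castSucc]
    cases a (Fin.last N) <;> simp [tileOp, ih, mul_comm]

theorem siteColumn_smul (t z : ℂ) (k : ℕ) {N : ℕ} (u : Fin N → ℂ) (a c : Fin N → Bool) (m : ℕ) :
    siteColumn t k N (fun i => z * u i) a c m = z ^ holes a * siteColumn t k N u a c m := by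
  have key (x : ℂ) (α γ : Bool) (s : ℂ) (f : ℕ → ℂ) (m : ℕ) :
      tileOp t (z * x) α γ (fun m => s * f m) m = s * z ^ edgeHole α * tileOp t x α γ f m := by
    cases α <;> cases γ <;> cases m <;> simp [tileOp, edgeHole] <;> ring
  induction N generalizing m with
  | zero => simp [siteColumn, holes]
  | succ N ih =>
    have := funext (ih (fun i => u i.castSucc) (fun i => a i.castSucc) fun i => c i.castSucc)
    simp only [siteColumn, this, key, holes_succ, pow_add]

theorem sum_levelNorm_tileOp (t x : ℂ) (a c : Bool) (K : ℕ) (f g : ℕ → ℂ)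
    (hg : ∀ m, K ≤ m → g m = 0) :
    ∑ m ∈ Finset.range (K + 1), levelNorm t m * tileOp t x a c g m * f m =
      ∑ m ∈ Finset.range K, levelNorm t m * g m * dualTileOp t x a c f m := by
  cases a <;> cases c
  · rw [Finset.sum_range_succ]
    simp only [tileOp, dualTileOp, LinearMap.coe_mk, AddHom.coe_mk, hg K le_rfl]
    rw [mul_zero, mul_zero, zero_mul, add_zero]
    exact Finset.sum_congr rfl fun m _ => by ring
  · rw [Finset.sum_range_succ']
    simp only [tileOp, dualTileOp, LinearMap.coe_mk, AddHom.coe_mk, levelNorm_succ]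
    rw [mul_zero, zero_mul, add_zero]
    exact Finset.sum_congr rfl fun m _ => by ring
  · rcases K with _ | K
    · simp [tileOp, hg]
    · rw [Finset.sum_range_succ, Finset.sum_range_succ, Finset.sum_range_succ']
      simp only [tileOp, dualTileOp, LinearMap.coe_mk, AddHom.coe_mk, levelNorm_succ,
        hg (K + 1) le_rfl, hg (K + 1 + 1) (Nat.le_succ _)]
      simp only [mul_zero, zero_mul, add_zero]
      exact Finset.sum_congr rfl fun m _ => by ring
  · rw [Finset.sum_range_succ]
    simp only [tileOp, dualTileOp, LinearMap.coe_mk, AddHom.coe_mk, hg K le_rfl]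
    simp

theorem dualColumn_eq_sum (t : ℂ) {M : ℕ} (v : Fin M → ℂ) (b d : Fin M → Bool) (f : ℕ → ℂ) :
    dualColumn t M v b d f =
      ∑ m ∈ Finset.range (M + 1), levelNorm t m * siteColumn t 0 M v b d m * f m := by
  induction M generalizing f with
  | zero => simp [dualColumn, siteColumn, levelNorm]
  | succ M ih =>
    simp only [siteColumn]
    rw [sum_levelNorm_tileOp, dualColumn, LinearMap.comp_apply, ih]
    intro m hm
    by_contra h
    have h1 := siteColumn_conservation h
    have h2 : holes (fun i : Fin M => b i.castSucc) ≤ M := by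
      calc _ ≤ ∑ i : Fin M, 1 := Finset.sum_le_sum fun i _ => by
            unfold edgeHole; split_ifs <;> simp
        _ = M := by simp
    omega

/-! ### States of the boson lattice, and transfer matrices site by site -/

/-- The state with occupation numbers `m, l 0, l 1, …`. -/
def consState (m : ℕ) (l : ℕ →₀ ℕ) : ℕ →₀ ℕ :=
  Finsupp.onFinset (insert 0 (l.support.map ⟨Nat.succ, Nat.succ_injective⟩))
    (fun i => Nat.casesOn i m l) (by rintro (_ | i) h <;> simp_all)

@[simp] theorem consState_zero (m : ℕ) (l : ℕ →₀ ℕ) : consState m l 0 = m := rfl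

@[simp] theorem consState_succ (m : ℕ) (l : ℕ →₀ ℕ) (i : ℕ) : consState m l (i + 1) = l i := rfl

/-- The state with occupation numbers `l 1, l 2, …`. -/
def tailState (l : ℕ →₀ ℕ) : ℕ →₀ ℕ := l.comapDomain Nat.succ Nat.succ_injective.injOn

@[simp] theorem tailState_apply (l : ℕ →₀ ℕ) (i : ℕ) : tailState l i = l (i + 1) := rfl

@[simp] theorem consState_tailState (l : ℕ →₀ ℕ) : consState (l 0) (tailState l) = l := by
  ext i
  cases i <;> simp

theorem consState_inj {m m' : ℕ} {l l' : ℕ →₀ ℕ} :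
    consState m l = consState m' l' ↔ m = m' ∧ l = l' := by
  refine ⟨fun h => ⟨DFunLike.congr_fun h 0, ?_⟩, by rintro ⟨rfl, rfl⟩; rfl⟩
  ext i
  exact DFunLike.congr_fun h (i + 1)

@[simp] theorem consState_zero_zero : consState 0 0 = 0 := by
  ext i
  cases i <;> rfl

theorem exists_forall_ge_eq_zero (l : ℕ →₀ ℕ) : ∃ L, ∀ i, L ≤ i → l i = 0 := by
  refine ⟨l.support.sup id + 1, fun i hi => ?_⟩
  by_contra h
  have := Finset.le_sup (f := id) (Finsupp.mem_support_iff.mpr h)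
  simp at this
  omega

theorem state_induction {p : (ℕ →₀ ℕ) → Prop} (h0 : p 0)
    (hc : ∀ m l, p l → p (consState m l)) (l : ℕ →₀ ℕ) : p l := by
  obtain ⟨L, hL⟩ := exists_forall_ge_eq_zero l
  induction L generalizing l with
  | zero =>
    convert h0
    ext i
    exact hL i (Nat.zero_le i)
  | succ L ih =>
    rw [← consState_tailState l]
    exact hc _ _ (ih _ fun i hi => hL (i + 1) (by omega))

@[to_additive]
theorem consState_prod {A : Type*} [CommMonoid A] (m : ℕ) (l : ℕ →₀ ℕ) (f : ℕ → ℕ → A)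
    (hf : ∀ i, f i 0 = 1) :
    (consState m l).prod f = f 0 m * l.prod fun i => f (i + 1) := by
  have h : (consState m l).support ⊆ insert 0 (l.support.map ⟨Nat.succ, Nat.succ_injective⟩) :=
    Finsupp.support_onFinset_subset
  rw [Finsupp.prod_of_support_subset _ h _ (fun i _ => hf i), Finset.prod_insert (by simp),
    Finset.prod_map]
  rfl

/-- Weight of a row with prescribed horizontal edges. -/
def configWeight (t x : ℂ) (bot top : ℕ →₀ ℕ) (e : ℕ → Bool) : ℂ :=
  ∏ᶠ i : ℕ, tileWeight t x (bot i) (e i) (e (i + 1)) (top i)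

theorem mulSupport_tileWeight_subset (t x : ℂ) (bot top : ℕ →₀ ℕ) {e : ℕ → Bool}
    (he : ∀ᶠ i in atTop, e i = true) :
    ∃ J, Function.mulSupport (fun i => tileWeight t x (bot i) (e i) (e (i + 1)) (top i)) ⊆
      Finset.range J := by
  obtain ⟨J, hJ⟩ := eventually_atTop.mp he
  obtain ⟨L, hL⟩ := exists_forall_ge_eq_zero bot
  obtain ⟨L', hL'⟩ := exists_forall_ge_eq_zero top
  refine ⟨J + L + L', fun i hi => ?_⟩
  by_contra h
  simp only [Finset.coe_range, Set.mem_Iio, not_lt] at h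
  apply hi
  simp [hJ i (by omega), hJ (i + 1) (by omega), hL i (by omega), hL' i (by omega), tileWeight]

theorem configWeight_succ (t x : ℂ) (m m' : ℕ) (bot top : ℕ →₀ ℕ) {e : ℕ → Bool}
    (he : ∀ᶠ i in atTop, e i = true) :
    configWeight t x (consState m bot) (consState m' top) e =
      tileWeight t x m (e 0) (e 1) m' * configWeight t x bot top fun i => e (i + 1) := by
  have he' : ∀ᶠ i in atTop, e (i + 1) = true := (tendsto_add_atTop_nat 1).eventually he
  obtain ⟨J, hJ⟩ := mulSupport_tileWeight_subset t x (consState m bot) (consState m' top) he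
  obtain ⟨J', hJ'⟩ := mulSupport_tileWeight_subset t x bot top he'
  unfold configWeight
  rw [finprod_eq_prod_of_mulSupport_subset _ (s := Finset.range (J + J' + 1)) (hJ.trans _),
    finprod_eq_prod_of_mulSupport_subset _ (s := Finset.range (J + J')) (hJ'.trans _),
    Finset.prod_range_succ', mul_comm]
  · rfl
  · exact_mod_cast Finset.range_mono (by omega)
  · exact_mod_cast Finset.range_mono (by omega)

theorem configWeight_support {t x : ℂ} {bot top : ℕ →₀ ℕ} {e : ℕ → Bool}
    (he : ∀ᶠ i in atTop, e i = true) (h : configWeight t x bot top e ≠ 0) {L : ℕ}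
    (hL : ∀ i, L ≤ i → bot i = 0) (i : ℕ) (hi : L ≤ i) : e i = true ∧ top i = 0 := by
  obtain ⟨J, hJ⟩ := eventually_atTop.mp he
  obtain ⟨K, hK⟩ := mulSupport_tileWeight_subset t x bot top he
  have hne (i : ℕ) : tileWeight t x (bot i) (e i) (e (i + 1)) (top i) ≠ 0 := fun h0 =>
    h (finprod_eq_zero _ i h0 ((Finset.finite_toSet _).subset hK))
  have step (i : ℕ) (hi : L ≤ i) (h1 : e (i + 1) = true) : e i = true ∧ top i = 0 := by
    have := hne i
    rw [hL i hi, h1] at this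
    revert this
    cases e i <;> simp [tileWeight, eq_comm]
  have all (k : ℕ) : ∀ i, L ≤ i → J ≤ i + k → e i = true := by
    induction k with
    | zero => exact fun i _ h => hJ i h
    | succ k ih => exact fun i hi h => (step i hi (ih (i + 1) (by omega) (by omega))).1
  exact step i hi (all J (i + 1) (by omega) (by omega))

theorem finite_configs (t x : ℂ) (bot top : ℕ →₀ ℕ) :
    ({e : ℕ → Bool | ∀ᶠ i in atTop, e i = true} ∩
      Function.support (configWeight t x bot top)).Finite := by
  obtain ⟨L, hL⟩ := exists_forall_ge_eq_zero bot
  refine (Set.finite_range fun (f : Fin L → Bool) (i : ℕ) =>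
    if h : i < L then f ⟨i, h⟩ else true).subset ?_
  rintro e ⟨he, h⟩
  refine ⟨fun i => e i, ?_⟩
  ext i
  by_cases hi : i < L
  · simp [hi]
  · simp [hi, (configWeight_support he h hL i (by omega)).1]

theorem rowElem_eq (t x : ℂ) (a : Bool) (bot top : ℕ →₀ ℕ) :
    rowElem t x a bot top =
      ∑ᶠ e ∈ {e : ℕ → Bool | e 0 = a ∧ ∀ᶠ i in atTop, e i = true}, configWeight t x bot top e :=
  rfl

theorem rowElem_zero (t x : ℂ) (a : Bool) (top : ℕ →₀ ℕ) :
    rowElem t x a 0 top = if a = true ∧ top = 0 then 1 else 0 := by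
  have key {e : ℕ → Bool} (he : ∀ᶠ i in atTop, e i = true) (h : configWeight t x 0 top e ≠ 0) :
      e = (fun _ => true) ∧ top = 0 := by
    have := configWeight_support he h (L := 0) (fun _ _ => rfl)
    exact ⟨funext fun i => (this i (Nat.zero_le i)).1, Finsupp.ext fun i => (this i (Nat.zero_le i)).2⟩
  rw [rowElem_eq]
  split_ifs with h
  · obtain ⟨rfl, rfl⟩ := h
    rw [finsum_mem_inter_support_eq _ _ {fun _ => true}, finsum_mem_singleton]
    · simp [configWeight, tileWeight]
    · ext e
      simp only [Set.mem_inter_iff, Set.mem_ofPred_eq, Function.mem_support, Set.mem_singleton_iff]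
      constructor
      · rintro ⟨⟨_, he⟩, h⟩
        exact ⟨(key he h).1, h⟩
      · rintro ⟨rfl, h⟩
        exact ⟨⟨rfl, by simp⟩, h⟩
  · refine finsum_mem_eq_zero_of_forall_eq_zero fun e ⟨he0, he⟩ => ?_
    by_contra h'
    obtain ⟨rfl, h2⟩ := key he h'
    exact h ⟨he0.symm, h2⟩

theorem rowElem_consState (t x : ℂ) (a : Bool) (m m' : ℕ) (bot top : ℕ →₀ ℕ) :
    rowElem t x a (consState m bot) (consState m' top) =
      ∑ c, tileWeight t x m a c m' * rowElem t x c bot top := by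
  have h1 : rowElem t x a (consState m bot) (consState m' top) =
      ∑ᶠ e ∈ {e : ℕ → Bool | ∀ᶠ i in atTop, e i = true},
        tileWeight t x m a (e 0) m' * configWeight t x bot top e := by
    rw [rowElem_eq]
    refine finsum_mem_eq_of_bijOn (fun e i => e (i + 1)) ⟨?_, ?_, ?_⟩ ?_
    · exact fun e he => (tendsto_add_atTop_nat 1).eventually he.2
    · intro e he e' he' h
      ext i
      rcases i with _ | i
      · rw [he.1, he'.1]
      · exact congrFun h i
    · intro e he
      refine ⟨fun i => Nat.casesOn i a e, ⟨rfl, ?_⟩, rfl⟩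
      obtain ⟨J, hJ⟩ := eventually_atTop.mp he
      refine eventually_atTop.mpr ⟨J + 1, fun i hi => ?_⟩
      rcases i with _ | i
      · omega
      · exact hJ i (by omega)
    · rintro e ⟨he0, he⟩
      rw [configWeight_succ t x m m' bot top he, he0]
  have h2 : {e : ℕ → Bool | ∀ᶠ i in atTop, e i = true} =
      {e : ℕ → Bool | e 0 = true ∧ ∀ᶠ i in atTop, e i = true} ∪
        {e : ℕ → Bool | e 0 = false ∧ ∀ᶠ i in atTop, e i = true} := by
    ext e
    simp only [Set.mem_ofPred_eq, Set.mem_union]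
    cases e 0 <;> simp
  have hfin (c : Bool) : ({e : ℕ → Bool | e 0 = c ∧ ∀ᶠ i in atTop, e i = true} ∩
      Function.support (configWeight t x bot top)).Finite :=
    (finite_configs t x bot top).subset fun e he => ⟨he.1.2, he.2⟩
  have hfin' (c : Bool) : ({e : ℕ → Bool | e 0 = c ∧ ∀ᶠ i in atTop, e i = true} ∩
      Function.support fun e => tileWeight t x m a (e 0) m' * configWeight t x bot top e).Finite :=
    (hfin c).subset fun e he => ⟨he.1, right_ne_zero_of_mul he.2⟩
  rw [h1, h2, finsum_mem_union' _ (hfin' true) (hfin' false), Fintype.sum_bool]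
  · congr 1 <;>
    · rw [rowElem_eq, ← smul_eq_mul, smul_finsum]
      refine finsum_congr fun e => ?_
      rw [smul_finsum]
      exact finsum_congr fun he => by rw [he.1, smul_eq_mul]
  · rw [Set.disjoint_left]
    rintro e ⟨h, _⟩ ⟨h', _⟩
    rw [h] at h'
    cases h'

theorem top_lt_of_tileWeight_ne_zero {t x : ℂ} {a c : Bool} {m k : ℕ}
    (h : tileWeight t x m a c k ≠ 0) : k ∈ Finset.range (m + 2) := by
  rw [Finset.mem_range]
  cases a <;> cases c <;> simp [tileWeight] at h <;> omega

theorem exists_rowElem_support (t : ℂ) (bot : ℕ →₀ ℕ) :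
    ∃ F : Finset (ℕ →₀ ℕ), ∀ x a top, rowElem t x a bot top ≠ 0 → top ∈ F := by
  induction bot using state_induction with
  | h0 =>
    refine ⟨{0}, fun x a top h => ?_⟩
    rw [rowElem_zero] at h
    simp at h
    simp [h]
  | hc m l ih =>
    obtain ⟨F, hF⟩ := ih
    refine ⟨(Finset.range (m + 2) ×ˢ F).image fun p => consState p.1 p.2, fun x a top h => ?_⟩
    rw [← consState_tailState top, rowElem_consState] at h
    obtain ⟨c, _, hc⟩ := Finset.exists_ne_zero_of_sum_ne_zero h
    refine Finset.mem_image.mpr ⟨(top 0, tailState top), Finset.mem_product.mpr ⟨?_, ?_⟩,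
      consState_tailState top⟩
    · exact top_lt_of_tileWeight_ne_zero (left_ne_zero_of_mul hc)
    · exact hF _ _ _ (right_ne_zero_of_mul hc)

theorem sum_tileWeight (t x : ℂ) (a c : Bool) (m : ℕ) (f : ℕ → ℂ) :
    ∑ k ∈ Finset.range (m + 2), tileWeight t x m a c k * f k = tileOp t x a c f m := by
  cases a <;> cases c <;> rcases m with _ | m <;>
    simp [tileWeight, tileOp, ite_mul]
  omega

/-- The matrix element `⟨bot| T_{a_N}(u_N) ⋯ T_{a_1}(u_1) |top⟩`. -/
def stackElem (t : ℂ) (top : ℕ →₀ ℕ) : (N : ℕ) → (Fin N → ℂ) → (Fin N → Bool) → (ℕ →₀ ℕ) → ℂ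
  | 0, _, _, bot => if bot = top then 1 else 0
  | N + 1, u, a, bot =>
      ∑ᶠ mid : ℕ →₀ ℕ, rowElem t (u (Fin.last N)) (a (Fin.last N)) bot mid *
        stackElem t top N (fun i => u i.castSucc) (fun i => a i.castSucc) mid

theorem stackElem_zero (t : ℂ) (top : ℕ →₀ ℕ) {N : ℕ} (u : Fin N → ℂ) (a : Fin N → Bool) :
    stackElem t top N u a 0 = if a = (fun _ => true) ∧ top = 0 then 1 else 0 := by
  induction N with
  | zero => simp [stackElem, Subsingleton.elim a fun _ => true, eq_comm]
  | succ N ih =>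
    rw [stackElem, finsum_eq_single _ 0]
    · rw [rowElem_zero, ih]
      simp only [funext_iff, Fin.forall_fin_succ']
      split_ifs <;> simp_all
    · intro mid h
      rw [rowElem_zero, if_neg (fun h' => h h'.2), zero_mul]

theorem stackElem_consState (t : ℂ) (k : ℕ) (top : ℕ →₀ ℕ) {N : ℕ} (u : Fin N → ℂ)
    (a : Fin N → Bool) (m : ℕ) (bot : ℕ →₀ ℕ) :
    stackElem t (consState k top) N u a (consState m bot) =
      ∑ c, siteColumn t k N u a c m * stackElem t top N u c bot := by
  induction N generalizing m bot with
  | zero =>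
    simp only [stackElem, siteColumn, consState_inj, ite_and]
    split_ifs <;> simp
  | succ N ih =>
    obtain ⟨F, hF⟩ := exists_rowElem_support t bot
    have h1 (c : Bool) (c' : Fin N → Bool) : stackElem t top (N + 1) u
        (Fin.snoc c' c : Fin (N + 1) → Bool) bot =
        ∑ mid ∈ F, rowElem t (u (Fin.last N)) c bot mid *
          stackElem t top N (fun i => u i.castSucc) c' mid := by
      simp only [stackElem, Fin.snoc_last, Fin.snoc_castSucc]
      refine finsum_eq_sum_of_support_subset _ fun mid h => ?_
      exact hF _ _ _ (left_ne_zero_of_mul h)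
    have h2 (c : Bool) (c' : Fin N → Bool) : siteColumn t k (N + 1) u a
        (Fin.snoc c' c : Fin (N + 1) → Bool) m =
        tileOp t (u (Fin.last N)) (a (Fin.last N)) c
          (siteColumn t k N (fun i => u i.castSucc) (fun i => a i.castSucc) c') m := by
      simp [siteColumn]
    rw [stackElem, finsum_eq_sum_of_support_subset
      (s := (Finset.range (m + 2) ×ˢ F).image fun p => consState p.1 p.2)]
    · rw [Finset.sum_image (by
        rintro ⟨i, l⟩ _ ⟨i', l'⟩ _ h
        simpa [consState_inj] using h), sum_snoc]
      simp only [rowElem_consState, ih, h1, h2, ← sum_tileWeight, Finset.sum_mul, Finset.mul_sum]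
      rw [Finset.sum_comm]
      refine Finset.sum_congr rfl fun c' _ => ?_
      rw [Finset.sum_comm]
      refine Finset.sum_congr rfl fun c _ => ?_
      rw [Finset.sum_product, Finset.sum_comm]
      exact Finset.sum_congr rfl fun _ _ => Finset.sum_congr rfl fun _ _ => by ring
    · intro mid h
      have h := left_ne_zero_of_mul h
      rw [← consState_tailState mid, rowElem_consState] at h
      obtain ⟨c, _, hc⟩ := Finset.exists_ne_zero_of_sum_ne_zero h
      refine Finset.mem_coe.mpr (Finset.mem_image.mpr ⟨(mid 0, tailState mid),
        Finset.mem_product.mpr ⟨?_, hF _ _ _ (right_ne_zero_of_mul hc)⟩, consState_tailState mid⟩)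
      exact top_lt_of_tileWeight_ne_zero (left_ne_zero_of_mul hc)

/-- Total number of particles. -/
def stateTotal (l : ℕ →₀ ℕ) : ℕ := l.sum fun _ m => m

/-- Sum of the positions of the particles, counted from one. -/
def stateWeight (l : ℕ →₀ ℕ) : ℕ := l.sum fun i m => (i + 1) * m

/-- `⟨l|l⟩`. -/
def stateNorm (t : ℂ) (l : ℕ →₀ ℕ) : ℂ := l.prod fun _ m => levelNorm t m

theorem stateTotal_consState (m : ℕ) (l : ℕ →₀ ℕ) :
    stateTotal (consState m l) = m + stateTotal l :=
  consState_sum _ _ _ fun _ => rfl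

theorem stateWeight_consState (m : ℕ) (l : ℕ →₀ ℕ) :
    stateWeight (consState m l) = stateTotal (consState m l) + stateWeight l := by
  rw [stateTotal_consState, stateWeight, consState_sum _ _ _ fun _ => mul_zero _, stateTotal,
    stateWeight, add_assoc, ← Finsupp.sum_add]
  simp only [add_mul, zero_add, one_mul]
  congr 1
  exact Finset.sum_congr rfl fun i _ => by ring

theorem stateNorm_consState (t : ℂ) (m : ℕ) (l : ℕ →₀ ℕ) :
    stateNorm t (consState m l) = levelNorm t m * stateNorm t l :=
  consState_prod _ _ _ fun _ => by simp [levelNorm]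

theorem le_stateTotal (l : ℕ →₀ ℕ) (i : ℕ) : l i ≤ stateTotal l := by
  by_cases h : l i = 0
  · simp [h]
  · exact Finset.single_le_sum (f := fun i => l i) (fun _ _ => Nat.zero_le _)
      (Finsupp.mem_support_iff.mpr h)

theorem holes_le {N : ℕ} (a : Fin N → Bool) : holes a ≤ N := by
  calc holes a ≤ ∑ i : Fin N, 1 := Finset.sum_le_sum fun i _ => by
        unfold edgeHole
        split_ifs <;> simp
    _ = N := by simp

theorem holes_eq_zero {N : ℕ} {a : Fin N → Bool} (h : holes a = 0) : a = fun _ => true := by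
  funext i
  have := Finset.sum_eq_zero_iff.mp h i (Finset.mem_univ i)
  revert this
  cases a i <;> simp [edgeHole]

theorem holes_true (N : ℕ) : holes (fun _ : Fin N => true) = 0 := by simp [holes, edgeHole]

theorem stackElem_vacuum_consState (t : ℂ) {N : ℕ} (u : Fin N → ℂ) (a : Fin N → Bool) (m : ℕ)
    (l : ℕ →₀ ℕ) :
    stackElem t 0 N u a (consState m l) =
      ∑ c, siteColumn t 0 N u a c m * stackElem t 0 N u c l := by
  conv_lhs => rw [← consState_zero_zero, stackElem_consState]

theorem stackElem_conservation {t : ℂ} {N : ℕ} {u : Fin N → ℂ} {a : Fin N → Bool} {l : ℕ →₀ ℕ}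
    (h : stackElem t 0 N u a l ≠ 0) : stateTotal l = holes a := by
  induction l using state_induction generalizing a with
  | h0 =>
    rw [stackElem_zero] at h
    simp only [and_true, ne_eq, ite_eq_right_iff, one_ne_zero, imp_false, not_not] at h
    rw [h, holes_true]
    rfl
  | hc m l ih =>
    rw [stackElem_vacuum_consState] at h
    obtain ⟨c, _, hc⟩ := Finset.exists_ne_zero_of_sum_ne_zero h
    have h1 := siteColumn_conservation (left_ne_zero_of_mul hc)
    have h2 := ih (right_ne_zero_of_mul hc)
    rw [stateTotal_consState]
    omega

theorem stackElem_smul (t z : ℂ) {N : ℕ} (u : Fin N → ℂ) (a : Fin N → Bool) (l : ℕ →₀ ℕ) :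
    stackElem t 0 N (fun i => z * u i) a l = z ^ stateWeight l * stackElem t 0 N u a l := by
  induction l using state_induction generalizing a with
  | h0 => simp [stackElem_zero, stateWeight]
  | hc m l ih =>
    by_cases h : stackElem t 0 N u a (consState m l) = 0
    · rw [h, mul_zero]
      rw [stackElem_vacuum_consState] at h ⊢
      simp only [siteColumn_smul, ih]
      calc _ = z ^ holes a * z ^ stateWeight l *
            ∑ c, siteColumn t 0 N u a c m * stackElem t 0 N u c l := by
            rw [Finset.mul_sum]
            exact Finset.sum_congr rfl fun _ _ => by ring
        _ = 0 := by rw [h, mul_zero]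
    · rw [stateWeight_consState, stackElem_conservation h, stackElem_vacuum_consState,
        stackElem_vacuum_consState, pow_add, Finset.mul_sum]
      simp only [siteColumn_smul, ih]
      exact Finset.sum_congr rfl fun _ _ => by ring

/-! ### Convergence -/

/-- A nonnegative matrix that is triangular with respect to a rank function, with diagonal
entries bounded by `r < 1` except at `s₀`, is a contraction for a weighted norm. -/
theorem exists_weight_of_triangular {S : Type*} [Fintype S] (D : S → S → ℝ)
    (hD : ∀ s s', 0 ≤ D s s') (s₀ : S) (rank : S → ℕ) (good : S → Prop) (r : ℝ) (hr : r < 1)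
    (hr0 : 0 ≤ r)
    (htri : ∀ s s', good s → D s s' ≠ 0 → s' ≠ s → rank s' < rank s)
    (hdiag : ∀ s, good s → s ≠ s₀ → D s s ≤ r) :
    ∃ (h : S → ℝ) (q : ℝ), 0 ≤ q ∧ q < 1 ∧ (∀ s, 1 ≤ h s) ∧
      ∀ s, good s → s ≠ s₀ → ∑ s', D s s' * h s' ≤ q * h s := by
  classical
  set A : ℝ := ∑ s, ∑ s', D s s'
  have hA : 0 ≤ A := Finset.sum_nonneg fun s _ => Finset.sum_nonneg fun s' _ => hD s s'
  have hpos : 0 < 1 - r := by linarith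
  set B : ℝ := 1 + 2 * A / (1 - r)
  have hB : 1 ≤ B := by
    have : 0 ≤ 2 * A / (1 - r) := by positivity
    linarith
  have hB0 : 0 < B := by linarith
  have hAB : A ≤ (1 - r) / 2 * B := by
    have : (1 - r) / 2 * B = (1 - r) / 2 + A := by
      simp only [B]
      field_simp
    linarith
  refine ⟨fun s => B ^ rank s, (1 + r) / 2, by linarith, by linarith,
    fun s => one_le_pow₀ hB, fun s hs hs0 => ?_⟩
  have h1 : ∑ s' ∈ Finset.univ.erase s, D s s' * B ^ rank s' ≤ (1 - r) / 2 * B ^ rank s := by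
    rcases Nat.eq_zero_or_pos (rank s) with h0 | h0
    · rw [Finset.sum_eq_zero]
      · positivity
      · intro s' hs'
        by_contra h
        have := htri s s' hs (left_ne_zero_of_mul h) (Finset.ne_of_mem_erase hs')
        omega
    · obtain ⟨k, hk⟩ := Nat.exists_eq_succ_of_ne_zero h0.ne'
      calc ∑ s' ∈ Finset.univ.erase s, D s s' * B ^ rank s'
          ≤ ∑ s' ∈ Finset.univ.erase s, D s s' * B ^ k := by
            refine Finset.sum_le_sum fun s' hs' => ?_
            by_cases h : D s s' = 0
            · simp [h]
            · have := htri s s' hs h (Finset.ne_of_mem_erase hs')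
              exact mul_le_mul_of_nonneg_left (pow_le_pow_right₀ hB (by omega)) (hD s s')
        _ ≤ A * B ^ k := by
            rw [← Finset.sum_mul]
            refine mul_le_mul_of_nonneg_right ?_ (by positivity)
            calc ∑ s' ∈ Finset.univ.erase s, D s s' ≤ ∑ s', D s s' :=
                  Finset.sum_le_sum_of_subset_of_nonneg (Finset.erase_subset _ _)
                    fun s' _ _ => hD s s'
              _ ≤ A := Finset.single_le_sum (f := fun s => ∑ s', D s s')
                  (fun s _ => Finset.sum_nonneg fun s' _ => hD s s') (Finset.mem_univ s)
        _ ≤ (1 - r) / 2 * B * B ^ k := mul_le_mul_of_nonneg_right hAB (by positivity)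
        _ = (1 - r) / 2 * B ^ rank s := by rw [hk, pow_succ]; ring
  rw [← Finset.add_sum_erase _ _ (Finset.mem_univ s)]
  have h2 : D s s * B ^ rank s ≤ r * B ^ rank s :=
    mul_le_mul_of_nonneg_right (hdiag s hs hs0) (by positivity)
  linarith

section Iteration

variable {S : Type*} [Fintype S] [DecidableEq S] {D : S → S → ℝ} {s₀ : S} {good : S → Prop}
  {h : S → ℝ} {q : ℝ}

theorem le_of_iterate_triangular (hD : ∀ s s', 0 ≤ D s s')
    (hgood : ∀ s s', good s → D s s' ≠ 0 → good s') (h₀ : ∀ s', D s₀ s' ≠ 0 → s' = s₀)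
    (h₁ : D s₀ s₀ ≤ 1) (hq1 : q ≤ 1) (hh : ∀ s, 1 ≤ h s)
    (hcon : ∀ s, good s → s ≠ s₀ → ∑ s', D s s' * h s' ≤ q * h s)
    (Q : ℕ → S → ℝ) (hQ0 : ∀ s, Q 0 s ≤ 1)
    (hQ : ∀ L s, Q (L + 1) s ≤ ∑ s', D s s' * Q L s') (L : ℕ) (s : S) (hs : good s) :
    Q L s ≤ h s := by
  induction L generalizing s with
  | zero => exact (hQ0 s).trans (hh s)
  | succ L ih =>
    have h1 : Q (L + 1) s ≤ ∑ s', D s s' * h s' := by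
      refine (hQ L s).trans (Finset.sum_le_sum fun s' _ => ?_)
      by_cases h : D s s' = 0
      · simp [h]
      · exact mul_le_mul_of_nonneg_left (ih s' (hgood s s' hs h)) (hD s s')
    have hp : 0 ≤ h s := zero_le_one.trans (hh s)
    by_cases hs0 : s = s₀
    · subst hs0
      refine h1.trans ?_
      rw [Finset.sum_eq_single s]
      · nlinarith
      · intro s' _ h2
        by_contra h3
        exact h2 (h₀ s' (left_ne_zero_of_mul h3))
      · simp
    · refine h1.trans ((hcon s hs hs0).trans ?_)
      nlinarith

theorem tendsto_zero_of_iterate_triangular (hD : ∀ s s', 0 ≤ D s s')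
    (hgood : ∀ s s', good s → D s s' ≠ 0 → good s') (h₀ : ∀ s', D s₀ s' ≠ 0 → s' = s₀)
    (hq0 : 0 ≤ q) (hq1 : q < 1) (hh : ∀ s, 1 ≤ h s)
    (hcon : ∀ s, good s → s ≠ s₀ → ∑ s', D s s' * h s' ≤ q * h s)
    (E : ℕ → S → ℂ) (hE0 : E 0 s₀ = 0)
    (hE : ∀ L s, ‖E (L + 1) s‖ ≤ ∑ s', D s s' * ‖E L s'‖) (s : S) (hs : good s) :
    Tendsto (fun L => E L s) atTop (nhds 0) := by
  have hz (L : ℕ) : E L s₀ = 0 := by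
    induction L with
    | zero => exact hE0
    | succ L ih =>
      refine norm_le_zero_iff.mp ((hE L s₀).trans (le_of_eq (Finset.sum_eq_zero fun s' _ => ?_)))
      by_cases h : D s₀ s' = 0
      · simp [h]
      · simp [h₀ s' h, ih]
  set A : ℝ := ∑ s, ‖E 0 s‖
  have hA : 0 ≤ A := Finset.sum_nonneg fun _ _ => norm_nonneg _
  have hp (s : S) : 0 ≤ h s := zero_le_one.trans (hh s)
  have key (L : ℕ) : ∀ s, good s → ‖E L s‖ ≤ A * q ^ L * h s := by
    induction L with
    | zero =>
      intro s _
      have h1 : ‖E 0 s‖ ≤ A := Finset.single_le_sum (f := fun s => ‖E 0 s‖)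
        (fun _ _ => norm_nonneg _) (Finset.mem_univ s)
      have := hh s
      rw [pow_zero, mul_one]
      nlinarith
    | succ L ih =>
      intro s hs
      by_cases hs0 : s = s₀
      · rw [hs0, hz, norm_zero]
        have := hp s₀
        positivity
      · calc ‖E (L + 1) s‖ ≤ ∑ s', D s s' * ‖E L s'‖ := hE L s
          _ ≤ ∑ s', A * q ^ L * (D s s' * h s') := by
            refine Finset.sum_le_sum fun s' _ => ?_
            by_cases h' : D s s' = 0
            · simp [h']
            · calc _ ≤ D s s' * (A * q ^ L * h s') :=
                    mul_le_mul_of_nonneg_left (ih s' (hgood s s' hs h')) (hD s s')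
                _ = _ := by ring
          _ ≤ A * q ^ L * (q * h s) := by
            rw [← Finset.mul_sum]
            exact mul_le_mul_of_nonneg_left (hcon s hs hs0) (by positivity)
          _ = _ := by ring
  refine squeeze_zero_norm (key · s hs) ?_
  have := ((tendsto_pow_atTop_nhds_zero_of_lt_one hq0 hq1).const_mul A).mul_const (h s)
  simpa using this

end Iteration

/-- States with less than `K` particles on each of the first `L` sites, and none elsewhere. -/
def boxStates (K : ℕ) : ℕ → Finset (ℕ →₀ ℕ)
  | 0 => {0}
  | L + 1 => (Finset.range K ×ˢ boxStates K L).image fun p => consState p.1 p.2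

theorem mem_boxStates {K L : ℕ} {l : ℕ →₀ ℕ} (hK : 0 < K) :
    l ∈ boxStates K L ↔ (∀ i, l i < K) ∧ ∀ i, L ≤ i → l i = 0 := by
  induction L generalizing l with
  | zero =>
    simp only [boxStates, Finset.mem_singleton]
    constructor
    · rintro rfl
      simp [hK]
    · exact fun h => Finsupp.ext fun i => h.2 i (Nat.zero_le i)
  | succ L ih =>
    simp only [boxStates, Finset.mem_image, Finset.mem_product, Finset.mem_range, Prod.exists, ih]
    constructor
    · rintro ⟨m, l, ⟨hm, h1, h2⟩, rfl⟩
      refine ⟨fun i => ?_, fun i hi => ?_⟩ <;> rcases i with _ | i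
      · exact hm
      · exact h1 i
      · omega
      · exact h2 i (by omega)
    · rintro ⟨h1, h2⟩
      exact ⟨l 0, tailState l, ⟨h1 0, fun i => h1 (i + 1), fun i hi => h2 (i + 1) (by omega)⟩,
        consState_tailState l⟩

theorem sum_boxStates_succ {A : Type*} [AddCommMonoid A] (K L : ℕ) (f : (ℕ →₀ ℕ) → A) :
    ∑ l ∈ boxStates K (L + 1), f l =
      ∑ m ∈ Finset.range K, ∑ l ∈ boxStates K L, f (consState m l) := by
  rw [boxStates, Finset.sum_image, Finset.sum_product]
  rintro ⟨i, l⟩ _ ⟨i', l'⟩ _ h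
  simpa [consState_inj] using h

/-- Summand of the Cauchy identity with open boundaries on the left and at the bottom. -/
def cauchyTerm (t : ℂ) {N M : ℕ} (u : Fin N → ℂ) (v : Fin M → ℂ)
    (s : (Fin N → Bool) × (Fin M → Bool)) (l : ℕ →₀ ℕ) : ℂ :=
  stateNorm t l * stackElem t 0 N u s.1 l * stackElem t 0 M v s.2 l

/-- One-site summand of the transfer matrix along the rows. -/
def columnTerm (t : ℂ) {N M : ℕ} (u : Fin N → ℂ) (v : Fin M → ℂ)
    (s s' : (Fin N → Bool) × (Fin M → Bool)) (m : ℕ) : ℂ :=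
  levelNorm t m * siteColumn t 0 N u s.1 s'.1 m * siteColumn t 0 M v s.2 s'.2 m

theorem cauchyTerm_consState (t : ℂ) {N M : ℕ} (u : Fin N → ℂ) (v : Fin M → ℂ)
    (s : (Fin N → Bool) × (Fin M → Bool)) (m : ℕ) (l : ℕ →₀ ℕ) :
    cauchyTerm t u v s (consState m l) =
      ∑ s', columnTerm t u v s s' m * cauchyTerm t u v s' l := by
  simp only [cauchyTerm, columnTerm, stateNorm_consState, stackElem_vacuum_consState,
    Fintype.sum_prod_type, Finset.mul_sum, Finset.sum_mul]
  rw [Finset.sum_comm]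
  exact Finset.sum_congr rfl fun _ _ => Finset.sum_congr rfl fun _ _ => by ring

theorem columnTerm_conservation {t : ℂ} {N M : ℕ} {u : Fin N → ℂ} {v : Fin M → ℂ}
    {s s' : (Fin N → Bool) × (Fin M → Bool)} {m : ℕ} (h : columnTerm t u v s s' m ≠ 0) :
    m + holes s'.1 = holes s.1 ∧ m + holes s'.2 = holes s.2 := by
  have h1 := siteColumn_conservation (right_ne_zero_of_mul (left_ne_zero_of_mul h))
  have h2 := siteColumn_conservation (right_ne_zero_of_mul h)
  omega

theorem columnTerm_triangular {t : ℂ} {N M : ℕ} {u : Fin N → ℂ} {v : Fin M → ℂ}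
    {s s' : (Fin N → Bool) × (Fin M → Bool)} {m : ℕ} (h : columnTerm t u v s s' m ≠ 0)
    (hs : s' ≠ s) : holeRank N s'.1 + holeRank M s'.2 < holeRank N s.1 + holeRank M s.2 := by
  obtain ⟨h1, h1'⟩ := siteColumn_triangular (right_ne_zero_of_mul (left_ne_zero_of_mul h))
  obtain ⟨h2, h2'⟩ := siteColumn_triangular (right_ne_zero_of_mul h)
  by_contra h3
  exact hs (Prod.ext (h1' (by omega)) (h2' (by omega)))

theorem norm_prod_le_pow_holes {N : ℕ} (u : Fin N → ℂ) (U : ℝ) (hu : ∀ i, ‖u i‖ ≤ U)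
    (a : Fin N → Bool) : ‖∏ i, (if a i then 1 else u i)‖ ≤ U ^ holes a := by
  rw [norm_prod, holes, ← Finset.prod_pow_eq_pow_sum]
  refine Finset.prod_le_prod (fun _ _ => norm_nonneg _) fun i _ => ?_
  cases a i <;> simp [edgeHole, hu]

theorem norm_columnTerm_self_le {t : ℂ} {N M : ℕ} {u : Fin N → ℂ} {v : Fin M → ℂ} {U V : ℝ}
    (hu : ∀ i, ‖u i‖ ≤ U) (hv : ∀ j, ‖v j‖ ≤ V) (hU : 0 ≤ U) (hV : 0 ≤ V) (hUV : U * V < 1)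
    {s : (Fin N → Bool) × (Fin M → Bool)} (hs : holes s.1 = holes s.2)
    (hs0 : s ≠ (fun _ => true, fun _ => true)) : ‖columnTerm t u v s s 0‖ ≤ U * V := by
  have hk : holes s.1 ≠ 0 := fun h => hs0 (Prod.ext (holes_eq_zero h) (holes_eq_zero (hs ▸ h)))
  rw [columnTerm, siteColumn_self, siteColumn_self, if_pos rfl, if_pos rfl, norm_mul, norm_mul]
  calc _ ≤ 1 * U ^ holes s.1 * V ^ holes s.1 := by
        gcongr
        · simp [levelNorm]
        · exact norm_prod_le_pow_holes u U hu _
        · exact hs ▸ norm_prod_le_pow_holes v V hv _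
    _ = (U * V) ^ holes s.1 := by rw [one_mul, mul_pow]
    _ ≤ U * V := pow_le_of_le_one (by positivity) hUV.le hk

theorem crossGrid_true (t : ℂ) {N M : ℕ} (u : Fin N → ℂ) (v : Fin M → ℂ) :
    crossGrid t u v (fun _ => true) (fun _ => true) = 1 := by
  have h1 (u : ℂ) (a : Bool) (d : Fin M → Bool) : crossRow t u v a (fun _ => true) d =
      if a = true ∧ d = fun _ => true then 1 else 0 := by
    induction M generalizing a with
    | zero => simp [crossRow, pathSum, Subsingleton.elim d fun _ => true]
    | succ M ih =>
      have := fun a => ih (fun i => v i.castSucc) a fun i => d i.castSucc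
      simp only [crossRow] at this
      simp only [crossRow, pathSum, Fintype.sum_bool, this]
      simp only [funext_iff, Fin.forall_fin_succ']
      cases a <;> cases d (Fin.last M) <;> simp [crossWeight, vertexWeight]
  induction N with
  | zero => simp [crossGrid, pathSum]
  | succ N ih =>
    have := ih fun i => u i.castSucc
    simp only [crossGrid] at this
    simp [crossGrid, pathSum, h1, this]

theorem cauchyTerm_vacuum (t : ℂ) {N M : ℕ} (u : Fin N → ℂ) (v : Fin M → ℂ)
    (s : (Fin N → Bool) × (Fin M → Bool)) :
    cauchyTerm t u v s 0 = if s = (fun _ => true, fun _ => true) then 1 else 0 := by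
  simp only [cauchyTerm, stackElem_zero, Prod.ext_iff, and_true]
  split_ifs <;> simp_all [stateNorm]

theorem mem_boxStates_of_cauchyTerm_ne_zero {t : ℂ} {N M : ℕ} {u : Fin N → ℂ} {v : Fin M → ℂ}
    {s : (Fin N → Bool) × (Fin M → Bool)} {l : ℕ →₀ ℕ} (h : cauchyTerm t u v s l ≠ 0) {L : ℕ}
    (hL : ∀ i, L ≤ i → l i = 0) : l ∈ boxStates (M + 1) L := by
  rw [mem_boxStates (Nat.succ_pos M)]
  refine ⟨fun i => ?_, hL⟩
  have h1 := stackElem_conservation (right_ne_zero_of_mul h)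
  have h2 := le_stateTotal l i
  have h3 := holes_le s.2
  omega

theorem exists_bound_states (F : Finset (ℕ →₀ ℕ)) :
    ∃ L, ∀ l ∈ F, (∀ i, L ≤ i → l i = 0) ∧ ∀ i, l i ≤ L := by
  classical
  choose f hf using exists_forall_ge_eq_zero
  refine ⟨F.sup f + F.sup stateTotal, fun l hl => ⟨fun i hi => hf l i ?_, fun i => ?_⟩⟩
  · have := Finset.le_sup (f := f) hl
    omega
  · have := Finset.le_sup (f := stateTotal) hl
    have := le_stateTotal l i
    omega

/-- The Cauchy identity with open boundaries. -/
theorem hasSum_cauchyTerm (t : ℂ) {N M : ℕ} (u : Fin N → ℂ) (v : Fin M → ℂ) {U V : ℝ}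
    (hu : ∀ i, ‖u i‖ ≤ U) (hv : ∀ j, ‖v j‖ ≤ V) (hU : 0 ≤ U) (hV : 0 ≤ V) (hUV : U * V < 1)
    (a : Fin N → Bool) (b : Fin M → Bool) (hab : holes a = holes b) :
    HasSum (cauchyTerm t u v (a, b)) (crossGrid t u v a b) := by
  set s₀ : (Fin N → Bool) × (Fin M → Bool) := (fun _ => true, fun _ => true) with hs₀
  set D : (Fin N → Bool) × (Fin M → Bool) → (Fin N → Bool) × (Fin M → Bool) → ℝ :=
    fun s s' => ∑ m ∈ Finset.range (M + 1), ‖columnTerm t u v s s' m‖ with hDdef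
  have hD (s s') : 0 ≤ D s s' := Finset.sum_nonneg fun _ _ => norm_nonneg _
  have hDne {s s'} (h : D s s' ≠ 0) : ∃ m, columnTerm t u v s s' m ≠ 0 := by
    obtain ⟨m, _, hm⟩ := Finset.exists_ne_zero_of_sum_ne_zero h
    exact ⟨m, norm_ne_zero_iff.mp hm⟩
  have hgood (s s') (hs : holes s.1 = holes s.2) (h : D s s' ≠ 0) :
      holes s'.1 = holes s'.2 := by
    obtain ⟨m, hm⟩ := hDne h
    have := columnTerm_conservation hm
    omega
  have hDself (s) : D s s = ‖columnTerm t u v s s 0‖ := by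
    refine Finset.sum_eq_single 0 (fun m _ hm => ?_) (by simp)
    rw [columnTerm, siteColumn_self, if_neg hm]
    simp
  have h₀ (s') (h : D s₀ s' ≠ 0) : s' = s₀ := by
    obtain ⟨m, hm⟩ := hDne h
    have := columnTerm_conservation hm
    simp only [hs₀, holes_true] at this
    exact Prod.ext (holes_eq_zero (by omega)) (holes_eq_zero (by omega))
  have h₁ : D s₀ s₀ ≤ 1 := by
    rw [hDself, columnTerm, siteColumn_self, siteColumn_self]
    simp [hs₀, levelNorm]
  obtain ⟨h, q, hq0, hq1, hh, hcon⟩ := exists_weight_of_triangular D hD s₀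
    (fun s => holeRank N s.1 + holeRank M s.2) (fun s => holes s.1 = holes s.2) (U * V) hUV
    (by positivity)
    (fun s s' _ h hne => by
      obtain ⟨m, hm⟩ := hDne h
      exact columnTerm_triangular hm hne)
    (fun s hs hs0 => (hDself s).trans_le (norm_columnTerm_self_le hu hv hU hV hUV hs hs0))
  have huv (i : Fin N) (j : Fin M) : u i * v j ≠ 1 := by
    intro h1
    have h2 : ‖u i‖ * ‖v j‖ ≤ U * V := mul_le_mul (hu i) (hv j) (norm_nonneg _) hU
    rw [← norm_mul, h1, norm_one] at h2
    linarith
  have hbound (L : ℕ) : ∑ l ∈ boxStates (M + 1) L, ‖cauchyTerm t u v (a, b) l‖ ≤ h (a, b) := by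
    refine le_of_iterate_triangular hD hgood h₀ h₁ hq1.le hh hcon
      (fun L s => ∑ l ∈ boxStates (M + 1) L, ‖cauchyTerm t u v s l‖) (fun s => ?_)
      (fun L s => ?_) L (a, b) hab
    · simp only [boxStates, Finset.sum_singleton, cauchyTerm_vacuum]
      split_ifs <;> simp
    · rw [sum_boxStates_succ]
      calc _ ≤ ∑ m ∈ Finset.range (M + 1), ∑ l ∈ boxStates (M + 1) L,
            ∑ s', ‖columnTerm t u v s s' m‖ * ‖cauchyTerm t u v s' l‖ := by
            refine Finset.sum_le_sum fun m _ => Finset.sum_le_sum fun l _ => ?_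
            rw [cauchyTerm_consState]
            exact (norm_sum_le _ _).trans_eq (Finset.sum_congr rfl fun _ _ => norm_mul _ _)
        _ = _ := by
            simp only [D, Finset.sum_mul_sum]
            conv_rhs => rw [Finset.sum_comm]
            refine Finset.sum_congr rfl fun m _ => ?_
            conv_rhs => rw [Finset.sum_comm]
  have hsum : Summable (cauchyTerm t u v (a, b)) := by
    refine Summable.of_norm (summable_of_sum_le (c := h (a, b)) (fun _ => norm_nonneg _) fun F => ?_)
    obtain ⟨L, hL⟩ := exists_bound_states F
    refine le_trans ?_ (hbound L)
    rw [← Finset.sum_filter_ne_zero]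
    refine Finset.sum_le_sum_of_subset_of_nonneg (fun l hl => ?_) fun _ _ _ => norm_nonneg _
    obtain ⟨hl, hne⟩ := Finset.mem_filter.mp hl
    exact mem_boxStates_of_cauchyTerm_ne_zero (norm_ne_zero_iff.mp hne) (hL l hl).1
  have hlim : Tendsto (fun L => ∑ l ∈ boxStates (M + 1) L, cauchyTerm t u v (a, b) l) atTop
      (nhds (crossGrid t u v a b)) := by
    have := tendsto_zero_of_iterate_triangular hD hgood h₀ hq0 hq1 hh hcon
      (fun L s => crossGrid t u v s.1 s.2 - ∑ l ∈ boxStates (M + 1) L, cauchyTerm t u v s l)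
      (by simp [boxStates, cauchyTerm_vacuum, crossGrid_true, hs₀]) (fun L s => ?_) (a, b) hab
    · simpa using this.const_sub (crossGrid t u v a b)
    · have h1 : crossGrid t u v s.1 s.2 - ∑ l ∈ boxStates (M + 1) (L + 1), cauchyTerm t u v s l =
          ∑ s', (∑ m ∈ Finset.range (M + 1), columnTerm t u v s s' m) *
            (crossGrid t u v s'.1 s'.2 - ∑ l ∈ boxStates (M + 1) L, cauchyTerm t u v s' l) := by
        simp only [mul_sub, Finset.sum_sub_distrib]
        congr 1
        · rw [← sum_dualColumn_siteColumn t v N u huv s.1 s.2, Fintype.sum_prod_type]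
          refine Finset.sum_congr rfl fun c _ => Finset.sum_congr rfl fun d _ => ?_
          rw [dualColumn_eq_sum]
          congr 1
          exact Finset.sum_congr rfl fun m _ => by simp only [columnTerm]; ring
        · rw [sum_boxStates_succ]
          simp only [cauchyTerm_consState, Finset.sum_mul_sum]
          conv_rhs => rw [Finset.sum_comm]
          refine Finset.sum_congr rfl fun m _ => ?_
          conv_rhs => rw [Finset.sum_comm]
      rw [h1]
      refine (norm_sum_le _ _).trans (Finset.sum_le_sum fun s' _ => ?_)
      rw [norm_mul]
      exact mul_le_mul_of_nonneg_right (norm_sum_le _ _) (norm_nonneg _)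
  have hex : Tendsto (fun L => boxStates (M + 1 + L) L) atTop atTop := by
    refine tendsto_atTop_finset_of_monotone (fun L L' hLL l => ?_) fun l => ?_
    · rw [mem_boxStates (by omega), mem_boxStates (by omega)]
      exact fun h => ⟨fun i => (h.1 i).trans_le (by omega), fun i hi => h.2 i (by omega)⟩
    · obtain ⟨L, hL⟩ := exists_bound_states {l}
      obtain ⟨h1, h2⟩ := hL l (Finset.mem_singleton_self l)
      refine ⟨L, (mem_boxStates (by omega)).mpr ⟨fun i => ?_, h1⟩⟩
      have := h2 i
      omega
  have hlim' := hsum.hasSum.comp hex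
  have heq : (fun F : Finset (ℕ →₀ ℕ) => ∑ l ∈ F, cauchyTerm t u v (a, b) l) ∘
      (fun L => boxStates (M + 1 + L) L) =
        fun L => ∑ l ∈ boxStates (M + 1) L, cauchyTerm t u v (a, b) l := by
    funext L
    refine (Finset.sum_subset (fun l => ?_) fun l hl hl' => ?_).symm
    · rw [mem_boxStates (by omega), mem_boxStates (by omega)]
      exact fun h => ⟨fun i => (h.1 i).trans_le (by omega), h.2⟩
    · by_contra hne
      exact hl' (mem_boxStates_of_cauchyTerm_ne_zero hne ((mem_boxStates (by omega)).mp hl).2)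
  rw [heq] at hlim'
  rw [← tendsto_nhds_unique hlim' hlim]
  exact hsum.hasSum

theorem prod_sum_path {S : Type*} [Fintype S] [DecidableEq S] (s₀ : S) (N M : ℕ)
    (K : Fin N → Fin M → S → S → ℂ) (a : Fin N → S) :
    ∏ r, pathSum s₀ M (K r) (a r) =
      ∑ h : Fin N → Fin (M + 1) → S, if (∀ r, h r 0 = s₀) ∧ (fun r => h r (Fin.last M)) = a then
        ∏ r, ∏ c : Fin M, K r c (h r c.succ) (h r c.castSucc) else 0 := by
  simp only [← sum_path]
  rw [Finset.prod_univ_sum, Fintype.piFinset_univ]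
  refine Finset.sum_congr rfl fun h _ => ?_
  split_ifs with hh
  · exact Finset.prod_congr rfl fun r _ => if_pos ⟨hh.1 r, congrFun hh.2 r⟩
  · obtain ⟨r, hr⟩ : ∃ r, ¬(h r 0 = s₀ ∧ h r (Fin.last M) = a r) := by
      by_contra! hr
      exact hh ⟨fun r => (hr r).1, funext fun r => (hr r).2⟩
    exact Finset.prod_eq_zero (Finset.mem_univ r) (if_neg hr)

theorem sum_grid (N M : ℕ) (W : Fin N → Fin M → Bool → Bool → Bool → Bool → ℂ)
    (f : (Fin N → Bool) → ℂ) (g : (Fin M → Bool) → ℂ) :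
    (∑ h : Fin N → Fin (M + 1) → Bool, ∑ v : Fin (N + 1) → Fin M → Bool,
      if (∀ r, h r 0 = true) ∧ v 0 = (fun _ => true) then
        (∏ r, ∏ c, W r c (h r c.succ) (h r c.castSucc) (v r.succ c) (v r.castSucc c)) *
          f (fun r => h r (Fin.last M)) * g (v (Fin.last N)) else 0) =
      ∑ a, ∑ b, f a * g b * pathSum (fun _ => true) N
        (fun r b d => pathSum true M (fun c l l' => W r c l l' (b c) (d c)) (a r)) b := by
  have h1 (v : Fin (N + 1) → Fin M → Bool) (a : Fin N → Bool) := prod_sum_path true N M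
    (fun r c l l' => W r c l l' (v r.succ c) (v r.castSucc c)) a
  simp only [← sum_path (S := Fin M → Bool), h1]
  calc _ = ∑ v : Fin (N + 1) → Fin M → Bool, ∑ h : Fin N → Fin (M + 1) → Bool, ∑ a, ∑ b,
      (if b = v (Fin.last N) then if a = (fun r => h r (Fin.last M)) then
        if (∀ r, h r 0 = true) ∧ v 0 = (fun _ => true) then
        (∏ r, ∏ c, W r c (h r c.succ) (h r c.castSucc) (v r.succ c) (v r.castSucc c)) *
          f a * g b else 0 else 0 else 0) := by
        simp only [Finset.sum_ite_eq', Finset.mem_univ, if_true]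
        rw [Finset.sum_comm]
    _ = ∑ a, ∑ b, ∑ v : Fin (N + 1) → Fin M → Bool, ∑ h : Fin N → Fin (M + 1) → Bool,
      (if b = v (Fin.last N) then if a = (fun r => h r (Fin.last M)) then
        if (∀ r, h r 0 = true) ∧ v 0 = (fun _ => true) then
        (∏ r, ∏ c, W r c (h r c.succ) (h r c.castSucc) (v r.succ c) (v r.castSucc c)) *
          f a * g b else 0 else 0 else 0) := by
        have e1 (F : (Fin (N + 1) → Fin M → Bool) → (Fin N → Fin (M + 1) → Bool) →
            (Fin N → Bool) → (Fin M → Bool) → ℂ) :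
            ∑ v, ∑ h, ∑ a, ∑ b, F v h a b = ∑ a, ∑ b, ∑ v, ∑ h, F v h a b := by
          calc _ = ∑ v, ∑ a, ∑ h, ∑ b, F v h a b :=
                Finset.sum_congr rfl fun v _ => Finset.sum_comm
            _ = ∑ a, ∑ v, ∑ h, ∑ b, F v h a b := Finset.sum_comm
            _ = ∑ a, ∑ v, ∑ b, ∑ h, F v h a b := Finset.sum_congr rfl fun a _ =>
                Finset.sum_congr rfl fun v _ => Finset.sum_comm
            _ = _ := Finset.sum_congr rfl fun a _ => Finset.sum_comm
        exact e1 _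
    _ = _ := by
        refine Finset.sum_congr rfl fun a _ => Finset.sum_congr rfl fun b _ => ?_
        rw [Finset.mul_sum]
        refine Finset.sum_congr rfl fun v _ => ?_
        by_cases hb : b = v (Fin.last N)
        · by_cases hv : v 0 = fun _ => true
          · rw [if_pos ⟨hv, hb.symm⟩, Finset.mul_sum]
            refine Finset.sum_congr rfl fun h _ => ?_
            simp only [hb, hv, eq_comm (a := a), and_true, if_true]
            split_ifs with h2 h3 h4 h4 <;> first | ring1 | (exfalso; tauto)
          · simp [hv]
        · rw [if_neg fun h => hb h.2.symm]
          simp [hb]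

/-- Product of the weights of the U-turns joining consecutive pairs of edges. -/
def uTurnProd (t : ℂ) {n : ℕ} (a : Fin (n * 2) → Bool) : ℂ :=
  ∏ i : Fin n, uTurn t (a (finProdFinEquiv (i, 0))) (a (finProdFinEquiv (i, 1)))

theorem uTurn_not_swap (t : ℂ) (a b : Bool) : uTurn t (!b) (!a) = uTurn t a b := by
  cases a <;> cases b <;> rfl

theorem ZUU_eq_sum_crossGrid {n : ℕ} (t z : ℂ) (x y : Fin n → ℂ) :
    ZUU t z x y = ∑ a, ∑ b, uTurnProd t a * uTurnProd t b *
      crossGrid t (fun i => z * doubled x i) (fun j => doubled (fun j => (y j)⁻¹) j) a b := by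
  have h1 := sum_grid (n * 2) (n * 2)
    (fun r c l l' b d => crossWeight t (z * doubled x r * doubled (fun j => (y j)⁻¹) c) l l' b d)
    (uTurnProd t) (uTurnProd t)
  have h2 (c : Fin (n * 2)) : doubled (fun j => (y j)⁻¹) c = (doubled y c)⁻¹ := by
    unfold doubled
    split_ifs <;> rfl
  unfold crossGrid crossRow
  rw [← h1]
  unfold ZUU
  refine Finset.sum_congr rfl fun h _ => ?_
  have hinv : Function.Involutive
      (fun (v : Fin (n * 2 + 1) → Fin (n * 2) → Bool) r c => !v r c) := fun v => by simp
  rw [← Equiv.sum_comp (hinv.toPerm _)]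
  refine Finset.sum_congr rfl fun v _ => ?_
  simp only [Function.Involutive.coe_toPerm, uTurnProd, uTurn_not_swap, funext_iff, h2,
    crossWeight, Bool.not_eq_false', div_eq_mul_inv]

/-! ### Double rows -/

theorem finsum_doubleRowElem (t x : ℂ) (bot : ℕ →₀ ℕ) (g : (ℕ →₀ ℕ) → ℂ) :
    ∑ᶠ mid, doubleRowElem t x bot mid * g mid =
      ∑ a, ∑ b, uTurn t a b * ∑ᶠ m, rowElem t x⁻¹ b bot m * ∑ᶠ mid, rowElem t x a m mid * g mid := by
  classical
  obtain ⟨F, hF⟩ := exists_rowElem_support t bot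
  choose F' hF' using exists_rowElem_support t
  have h1 (a b : Bool) (mid : ℕ →₀ ℕ) : ∑ᶠ m, rowElem t x⁻¹ b bot m * rowElem t x a m mid =
      ∑ m ∈ F, rowElem t x⁻¹ b bot m * rowElem t x a m mid :=
    finsum_eq_sum_of_support_subset _ fun m h => hF _ _ _ (left_ne_zero_of_mul h)
  have h2 (a b : Bool) : ∑ᶠ m, rowElem t x⁻¹ b bot m * ∑ᶠ mid, rowElem t x a m mid * g mid =
      ∑ m ∈ F, rowElem t x⁻¹ b bot m * ∑ mid ∈ F.biUnion F', rowElem t x a m mid * g mid := by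
    rw [finsum_eq_sum_of_support_subset (s := F) _
      fun m h => hF _ _ _ (left_ne_zero_of_mul h)]
    refine Finset.sum_congr rfl fun m hm => ?_
    rw [finsum_eq_sum_of_support_subset (s := F.biUnion F')]
    exact fun mid h => Finset.mem_coe.mpr (Finset.mem_biUnion.mpr
      ⟨m, hm, hF' _ _ _ _ (left_ne_zero_of_mul h)⟩)
  have h3 : (Function.support fun mid => doubleRowElem t x bot mid * g mid) ⊆
      (F.biUnion F' : Finset _) := by
    intro mid h
    have h := left_ne_zero_of_mul h
    simp only [doubleRowElem, h1] at h
    obtain ⟨a, _, h⟩ := Finset.exists_ne_zero_of_sum_ne_zero h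
    obtain ⟨b, _, h⟩ := Finset.exists_ne_zero_of_sum_ne_zero h
    obtain ⟨m, hm, h⟩ := Finset.exists_ne_zero_of_sum_ne_zero (right_ne_zero_of_mul h)
    exact Finset.mem_coe.mpr (Finset.mem_biUnion.mpr ⟨m, hm, hF' _ _ _ _ (right_ne_zero_of_mul h)⟩)
  rw [finsum_eq_sum_of_support_subset _ h3]
  simp only [doubleRowElem, h1, h2, Finset.sum_mul, Finset.mul_sum]
  rw [Finset.sum_comm]
  refine Finset.sum_congr rfl fun a _ => ?_
  rw [Finset.sum_comm]
  refine Finset.sum_congr rfl fun b _ => ?_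
  rw [Finset.sum_comm]
  exact Finset.sum_congr rfl fun _ _ => Finset.sum_congr rfl fun _ _ => by ring

theorem finsum_rowElem_mul_sum {ι : Type*} [Fintype ι] (t x : ℂ) (a : Bool) (bot : ℕ →₀ ℕ)
    (c : ι → ℂ) (g : ι → (ℕ →₀ ℕ) → ℂ) :
    ∑ᶠ mid, rowElem t x a bot mid * ∑ i, c i * g i mid =
      ∑ i, c i * ∑ᶠ mid, rowElem t x a bot mid * g i mid := by
  obtain ⟨F, hF⟩ := exists_rowElem_support t bot
  have h (g : (ℕ →₀ ℕ) → ℂ) : ∑ᶠ mid, rowElem t x a bot mid * g mid =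
      ∑ mid ∈ F, rowElem t x a bot mid * g mid :=
    finsum_eq_sum_of_support_subset _ fun m h => hF _ _ _ (left_ne_zero_of_mul h)
  rw [h]
  simp only [h]
  simp only [Finset.mul_sum]
  rw [Finset.sum_comm]
  exact Finset.sum_congr rfl fun _ _ => Finset.sum_congr rfl fun _ _ => by ring

theorem latticeElem_eq_sum_cast (t : ℂ) (n : ℕ) (x : Fin n → ℂ) (bot : ℕ →₀ ℕ) (N : ℕ)
    (hN : n * 2 = N) :
    latticeElem t n x bot = ∑ a : Fin N → Bool, (∏ i : Fin n,
      uTurn t (a ((finProdFinEquiv (i, 0)).cast hN)) (a ((finProdFinEquiv (i, 1)).cast hN))) *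
        stackElem t 0 N (fun r => doubled x (r.cast hN.symm)) a bot := by
  induction n generalizing N bot with
  | zero =>
    obtain rfl : N = 0 := by omega
    simp [latticeElem, stackElem]
  | succ n ih =>
    obtain rfl : N = n * 2 + 1 + 1 := by omega
    have hx1 : doubled x ((Fin.last (n * 2 + 1)).cast hN.symm) = (x (Fin.last n))⁻¹ := by
      have h1 : (n + 1 + n) % 2 = 1 := by omega
      have h2 : (n + 1 + n) / 2 = n := by omega
      simp [doubled, Fin.modNat, Fin.divNat, h1, h2]
      rfl
    have hx0 : doubled x ((Fin.last (n * 2)).castSucc.cast hN.symm) = x (Fin.last n) := by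
      simp [doubled, Fin.modNat, Fin.divNat]
      rfl
    have hx (r : Fin (n * 2)) : doubled x (r.castSucc.castSucc.cast hN.symm) =
        doubled (fun i => x i.castSucc) r := rfl
    have hi1 : (finProdFinEquiv (Fin.last n, (1 : Fin 2))).cast hN = Fin.last (n * 2 + 1) := by
      simp [Fin.ext_iff]
      omega
    have hi0 : (finProdFinEquiv (Fin.last n, (0 : Fin 2))).cast hN =
        (Fin.last (n * 2)).castSucc := by
      simp [Fin.ext_iff]
      omega
    have hi (i : Fin n) (j : Fin 2) : (finProdFinEquiv (i.castSucc, j)).cast hN =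
        (finProdFinEquiv (i, j)).castSucc.castSucc := by
      simp [Fin.ext_iff]
    simp only [sum_snoc, stackElem, Fin.prod_univ_castSucc, hx1, hx0, hx, hi1, hi0, hi,
      Fin.snoc_last, Fin.snoc_castSucc, latticeElem, finsum_doubleRowElem]
    have ih' (mid : ℕ →₀ ℕ) := ih (fun i => x i.castSucc) mid (n * 2) rfl
    simp only [ih', finsum_rowElem_mul_sum, Fin.cast_eq_self]
    simp only [Finset.mul_sum]
    simp only [Fintype.sum_bool, ← Finset.sum_add_distrib]
    exact Finset.sum_congr rfl fun _ _ => by ring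

theorem latticeElem_eq_sum (t : ℂ) (n : ℕ) (x : Fin n → ℂ) (bot : ℕ →₀ ℕ) :
    latticeElem t n x bot = ∑ a, uTurnProd t a * stackElem t 0 (n * 2) (doubled x) a bot :=
  latticeElem_eq_sum_cast t n x bot (n * 2) rfl

/-! ### Reflection symmetry -/

/-- Intertwiner of two rows of tiles with spectral parameters `x` and `y`. -/
def rowIntertwiner (t x y : ℂ) (a b c d : Bool) : ℂ :=
  match a, b, c, d with
  | false, false, false, false => x - t * y
  | true, true, true, true => x - t * y
  | false, true, false, true => y * (1 - t)
  | false, true, true, false => t * (x - y)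
  | true, false, false, true => x - y
  | true, false, true, false => x * (1 - t)
  | _, _, _, _ => 0

theorem tileOp_intertwining (t x y : ℂ) (a b e f : Bool) (g : ℕ → ℂ) (m : ℕ) :
    ∑ c, ∑ d, rowIntertwiner t x y a b c d * tileOp t y d f (tileOp t x c e g) m =
      ∑ c, ∑ d, tileOp t x b d (tileOp t y a c g) m * rowIntertwiner t x y c d e f := by
  rcases m with _ | _ | m <;> cases a <;> cases b <;> cases e <;> cases f <;>
    simp only [Fintype.sum_bool, rowIntertwiner, tileOp] <;> ring

theorem sum_fin_two {A : Type*} [AddCommMonoid A] (F : (Fin 2 → Bool) → A) :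
    ∑ c, F c = ∑ c, ∑ d, F ![c, d] := by
  rw [← (finTwoArrowEquiv Bool).symm.sum_comp, Fintype.sum_prod_type]
  rfl

theorem stackElem_intertwining (t x y : ℂ) (bot top : ℕ →₀ ℕ) (a b : Bool) :
    ∑ c, ∑ d, rowIntertwiner t x y a b c d * stackElem t top 2 ![x, y] ![c, d] bot =
      (x - t * y) * stackElem t top 2 ![y, x] ![a, b] bot := by
  induction bot using state_induction generalizing top a b with
  | h0 =>
    have h (c d : Bool) : ![c, d] = (fun _ => true) ↔ c = true ∧ d = true := by
      simp [funext_iff, Fin.forall_fin_two]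
    simp only [stackElem_zero, h]
    by_cases ht : top = 0 <;> cases a <;> cases b <;> simp [rowIntertwiner, ht]
  | hc m bot ih =>
    rw [← consState_tailState top]
    have h (x y : ℂ) (a b c d : Bool) : siteColumn t (top 0) 2 ![x, y] ![a, b] ![c, d] m =
        tileOp t y b d (tileOp t x a c fun k => if k = top 0 then 1 else 0) m := rfl
    simp only [stackElem_consState, sum_fin_two, h]
    calc _ = ∑ e, ∑ f, (∑ c, ∑ d, rowIntertwiner t x y a b c d *
          tileOp t y d f (tileOp t x c e fun k => if k = top 0 then 1 else 0) m) *
            stackElem t (tailState top) 2 ![x, y] ![e, f] bot := by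
          simp only [Fintype.sum_bool]
          ring
      _ = ∑ c, ∑ d, tileOp t x b d (tileOp t y a c fun k => if k = top 0 then 1 else 0) m *
          ∑ e, ∑ f, rowIntertwiner t x y c d e f *
            stackElem t (tailState top) 2 ![x, y] ![e, f] bot := by
          simp only [tileOp_intertwining]
          simp only [Fintype.sum_bool]
          ring
      _ = _ := by
          simp only [ih]
          simp only [Fintype.sum_bool]
          ring

theorem doubleRowElem_eq (t x : ℂ) (bot top : ℕ →₀ ℕ) :
    doubleRowElem t x bot top =
      ∑ a, ∑ b, uTurn t a b * stackElem t top 2 ![x, x⁻¹] ![a, b] bot := by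
  refine Finset.sum_congr rfl fun a _ => Finset.sum_congr rfl fun b _ => ?_
  congr 1
  refine finsum_congr fun mid => ?_
  congr 1
  simp only [stackElem]
  rw [finsum_eq_single _ top (fun m h => by rw [if_neg h, mul_zero]), if_pos rfl, mul_one]
  rfl

theorem doubleRowElem_inv (t x : ℂ) (bot top : ℕ →₀ ℕ) :
    (x⁻¹ - t * x) * doubleRowElem t x bot top =
      (x - t * x⁻¹) * doubleRowElem t x⁻¹ bot top := by
  have h := fun a b => stackElem_intertwining t x x⁻¹ bot top a b
  have h1 := h false true
  have h2 := h true false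
  simp only [doubleRowElem_eq, inv_inv]
  simp only [Fintype.sum_bool, rowIntertwiner, uTurn] at h1 h2 ⊢
  linear_combination h1 - t * h2

theorem latticeElem_inv (t : ℂ) (n : ℕ) (x : Fin n → ℂ) (bot : ℕ →₀ ℕ) :
    (∏ i, ((x i)⁻¹ - t * x i)) * latticeElem t n x bot =
      (∏ i, (x i - t * (x i)⁻¹)) * latticeElem t n (fun i => (x i)⁻¹) bot := by
  induction n generalizing bot with
  | zero => simp [latticeElem]
  | succ n ih =>
    simp only [Fin.prod_univ_castSucc, latticeElem]
    simp only [← smul_eq_mul, smul_finsum]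
    refine finsum_congr fun mid => ?_
    simp only [smul_eq_mul]
    have h1 := ih (fun i => x i.castSucc) mid
    have h2 := doubleRowElem_inv t (x (Fin.last n)) bot mid
    calc _ = ((x (Fin.last n))⁻¹ - t * x (Fin.last n)) * doubleRowElem t (x (Fin.last n)) bot mid *
          ((∏ i : Fin n, ((x i.castSucc)⁻¹ - t * x i.castSucc)) *
            latticeElem t n (fun i => x i.castSucc) mid) := by ring
      _ = _ := by
        rw [h1, h2]
        ring

/-! ### Partitions as states -/

theorem partState_apply {n : ℕ} (lam : Fin n → ℕ) (j : ℕ) :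
    partState lam j = (List.ofFn lam).count j := by
  change (Finset.univ.filter fun k => lam k = j).card = _
  rw [← Multiset.coe_count, ← Fin.univ_val_map, Multiset.count_map]
  simp only [eq_comm (a := j)]
  rfl

theorem partState_injOn {n : ℕ} {lam mu : Fin n → ℕ} (h1 : Antitone lam) (h2 : Antitone mu)
    (h : partState lam = partState mu) : lam = mu := by
  have hp : (List.ofFn lam).Perm (List.ofFn mu) := by
    rw [List.perm_iff_count]
    intro j
    rw [← partState_apply, h, partState_apply]
  exact List.ofFn_injective (hp.eq_of_pairwise' h1.sortedGE_ofFn.pairwise h2.sortedGE_ofFn.pairwise)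

theorem exists_partState_eq {n : ℕ} (l : ℕ →₀ ℕ) (hl : stateTotal l = n) :
    ∃ lam : Fin n → ℕ, Antitone lam ∧ partState lam = l := by
  set s : List ℕ := (Finsupp.toMultiset l).sort (· ≥ ·) with hs
  have hlen : s.length = n := by
    rw [hs, Multiset.length_sort, Finsupp.card_toMultiset, ← hl]
    rfl
  subst hlen
  have hof : List.ofFn s.get = s := List.ofFn_get s
  refine ⟨s.get, ?_, ?_⟩
  · have h1 : (List.ofFn s.get).SortedGE := by
      rw [hof]
      exact (Multiset.pairwise_sort _ _).sortedGE
    exact h1.antitone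
  · ext j
    rw [partState_apply, hof, ← Multiset.coe_count, hs, Multiset.sort_eq, Finsupp.count_toMultiset]

theorem partState_support_subset {n : ℕ} (lam : Fin n → ℕ) :
    (partState lam).support ⊆ Finset.univ.image lam := Finsupp.support_onFinset_subset

theorem stateWeight_partState {n : ℕ} (lam : Fin n → ℕ) :
    stateWeight (partState lam) = n + ∑ k, lam k := by
  rw [stateWeight, Finsupp.sum_of_support_subset _ (partState_support_subset lam) _
    fun _ _ => mul_zero _]
  have h1 := Finset.sum_fiberwise_of_maps_to (s := Finset.univ) (t := Finset.univ.image lam)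
    (g := lam) (fun k hk => Finset.mem_image_of_mem lam hk) fun k => lam k + 1
  have h2 : ∑ k, (lam k + 1) = n + ∑ k, lam k := by
    rw [Finset.sum_add_distrib, add_comm]
    simp
  rw [← h2, ← h1]
  refine Finset.sum_congr rfl fun j _ => ?_
  rw [Finset.sum_congr rfl fun k hk => by rw [(Finset.mem_filter.mp hk).2], Finset.sum_const,
    smul_eq_mul, mul_comm]
  rfl

theorem stateNorm_partState {n : ℕ} (t : ℂ) (lam : Fin n → ℕ) :
    stateNorm t (partState lam) = zeroPartFactor t lam * bFactor t lam := by
  rw [stateNorm, Finsupp.prod_of_support_subset _ (s := insert 0 (Finset.univ.image lam))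
    ((partState_support_subset lam).trans (Finset.subset_insert _ _)) _
    fun _ _ => by simp [levelNorm]]
  have h : insert 0 (Finset.univ.image lam) =
      insert 0 ((Finset.univ.image lam).filter fun j => 1 ≤ j) := by
    ext j
    rcases j with _ | j <;> simp
  rw [h, Finset.prod_insert (by simp)]
  rfl

/-! ### Summation with U-turns -/

theorem holes_of_uTurnProd_ne_zero {t : ℂ} {n : ℕ} {a : Fin (n * 2) → Bool}
    (h : uTurnProd t a ≠ 0) : holes a = n := by
  rw [holes, ← finProdFinEquiv.sum_comp, Fintype.sum_prod_type]
  calc _ = ∑ i : Fin n, 1 := by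
        refine Finset.sum_congr rfl fun i _ => ?_
        have := Finset.prod_ne_zero_iff.mp h i (Finset.mem_univ i)
        rw [Fin.sum_univ_two]
        revert this
        cases a (finProdFinEquiv (i, 0)) <;> cases a (finProdFinEquiv (i, 1)) <;>
          simp [uTurn, edgeHole]
    _ = n := by simp

theorem stateTotal_of_latticeElem_ne_zero {t : ℂ} {n : ℕ} {x : Fin n → ℂ} {l : ℕ →₀ ℕ}
    (h : latticeElem t n x l ≠ 0) : stateTotal l = n := by
  rw [latticeElem_eq_sum] at h
  obtain ⟨a, _, ha⟩ := Finset.exists_ne_zero_of_sum_ne_zero h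
  rw [stackElem_conservation (right_ne_zero_of_mul ha),
    holes_of_uTurnProd_ne_zero (left_ne_zero_of_mul ha)]

theorem exists_norm_bounds {ι κ : Type*} [Finite ι] [Finite κ] (u : ι → ℂ) (v : κ → ℂ)
    (h : ∀ i j, ‖u i * v j‖ < 1) :
    ∃ U V : ℝ, (∀ i, ‖u i‖ ≤ U) ∧ (∀ j, ‖v j‖ ≤ V) ∧ 0 ≤ U ∧ 0 ≤ V ∧ U * V < 1 := by
  rcases isEmpty_or_nonempty ι with hi | hi
  · obtain ⟨V, hV⟩ := (Set.finite_range fun j => ‖v j‖).bddAbove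
    exact ⟨0, max V 0, fun i => hi.elim i, fun j => (hV ⟨j, rfl⟩).trans (le_max_left _ _), le_rfl,
      le_max_right _ _, by simp⟩
  rcases isEmpty_or_nonempty κ with hk | hk
  · obtain ⟨U, hU⟩ := (Set.finite_range fun i => ‖u i‖).bddAbove
    exact ⟨max U 0, 0, fun i => (hU ⟨i, rfl⟩).trans (le_max_left _ _), fun j => hk.elim j,
      le_max_right _ _, le_rfl, by simp⟩
  obtain ⟨i, hi⟩ := Finite.exists_max fun i => ‖u i‖
  obtain ⟨j, hj⟩ := Finite.exists_max fun j => ‖v j‖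
  exact ⟨‖u i‖, ‖v j‖, hi, hj, norm_nonneg _, norm_nonneg _, norm_mul (u i) (v j) ▸ h i j⟩

theorem hasSum_latticeElem {n : ℕ} (t z : ℂ) (x y : Fin n → ℂ)
    (hz : ∀ i j, ‖z * doubled x i * doubled y j‖ < 1) :
    HasSum (fun l => z ^ stateWeight l * stateNorm t l * latticeElem t n x l * latticeElem t n y l)
      (∑ a, ∑ b, uTurnProd t a * uTurnProd t b *
        crossGrid t (fun i => z * doubled x i) (doubled y) a b) := by
  obtain ⟨U, V, hU, hV, hU0, hV0, hUV⟩ := exists_norm_bounds _ _ hz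
  have h1 (l : ℕ →₀ ℕ) :
      z ^ stateWeight l * stateNorm t l * latticeElem t n x l * latticeElem t n y l =
        ∑ a, ∑ b, uTurnProd t a * uTurnProd t b *
          cauchyTerm t (fun i => z * doubled x i) (doubled y) (a, b) l := by
    simp only [latticeElem_eq_sum, cauchyTerm, stackElem_smul, Finset.mul_sum, Finset.sum_mul]
    rw [Finset.sum_comm]
    exact Finset.sum_congr rfl fun _ _ => Finset.sum_congr rfl fun _ _ => by ring
  simp only [h1]
  refine hasSum_sum fun a _ => hasSum_sum fun b _ => ?_
  by_cases hab : uTurnProd t a * uTurnProd t b = 0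
  · simp only [hab, zero_mul]
    exact hasSum_zero
  · refine (hasSum_cauchyTerm t _ _ hU hV hU0 hV0 hUV a b ?_).mul_left _
    rw [holes_of_uTurnProd_ne_zero (left_ne_zero_of_mul hab),
      holes_of_uTurnProd_ne_zero (right_ne_zero_of_mul hab)]

theorem hasSum_partitions {n : ℕ} (t z : ℂ) (x y : Fin n → ℂ)
    (hz : ∀ i j, ‖z * doubled x i * doubled y j‖ < 1) :
    HasSum (fun lam : {lam : Fin n → ℕ // Antitone lam} =>
        z ^ (n + ∑ k, lam.1 k) * zeroPartFactor t lam.1 * bFactor t lam.1 *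
          latticeElem t n x (partState lam.1) * latticeElem t n y (partState lam.1))
      (∑ a, ∑ b, uTurnProd t a * uTurnProd t b *
        crossGrid t (fun i => z * doubled x i) (doubled y) a b) := by
  have h := hasSum_latticeElem t z x y hz
  have hinj : Function.Injective fun lam : {lam : Fin n → ℕ // Antitone lam} => partState lam.1 :=
    fun lam mu h => Subtype.ext (partState_injOn lam.2 mu.2 h)
  rw [← hinj.hasSum_iff] at h
  · convert h using 2 with lam
    simp only [Function.comp_apply, stateWeight_partState, stateNorm_partState]
    ring
  · intro l hl
    by_contra hne
    obtain ⟨lam, h1, h2⟩ := exists_partState_eq l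
      (stateTotal_of_latticeElem_ne_zero (right_ne_zero_of_mul hne))
    exact hl ⟨⟨lam, h1⟩, h2⟩

theorem sub_mul_inv_ne_zero {t x : ℂ} (hx : x ≠ 0) (hxt : x ^ 2 ≠ t) : x - t * x⁻¹ ≠ 0 := by
  intro h
  apply hxt
  field_simp at h
  linear_combination h

end DoublyReflecting

end

theorem mainTheorem4 (n : ℕ) (t z : ℂ) (x y : Fin n → ℂ)
    (hx : ∀ i, x i ≠ 0) (hy : ∀ i, y i ≠ 0)
    (hxt : ∀ i, x i ^ 2 ≠ t) (hyt : ∀ i, y i ^ 2 ≠ t)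
    (hz : ∀ i j, ‖z * x i * y j‖ < 1 ∧ ‖z * x i * (y j)⁻¹‖ < 1 ∧
      ‖z * (x i)⁻¹ * y j‖ < 1 ∧ ‖z * (x i)⁻¹ * (y j)⁻¹‖ < 1) :
    Summable (fun lam : {lam : Fin n → ℕ // Antitone lam} =>
      z ^ (n + ∑ k, lam.1 k) * DoublyReflecting.zeroPartFactor t lam.1 *
        DoublyReflecting.bFactor t lam.1 *
        DoublyReflecting.hallLittlewoodBC t x lam.1 *
        DoublyReflecting.hallLittlewoodBC t y lam.1) ∧
    (∏ j, (x j - t * (x j)⁻¹) * ((y j)⁻¹ - t * y j)) *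
      ∑' lam : {lam : Fin n → ℕ // Antitone lam},
        z ^ (n + ∑ k, lam.1 k) * DoublyReflecting.zeroPartFactor t lam.1 *
          DoublyReflecting.bFactor t lam.1 *
          DoublyReflecting.hallLittlewoodBC t x lam.1 *
          DoublyReflecting.hallLittlewoodBC t y lam.1 =
      DoublyReflecting.ZUU t z x y := by
  open DoublyReflecting in
  have hX : ∏ i, (x i - t * (x i)⁻¹) ≠ 0 :=
    Finset.prod_ne_zero_iff.mpr fun i _ => sub_mul_inv_ne_zero (hx i) (hxt i)
  have hY : ∏ i, (y i - t * (y i)⁻¹) ≠ 0 :=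
    Finset.prod_ne_zero_iff.mpr fun i _ => sub_mul_inv_ne_zero (hy i) (hyt i)
  have h1 := hasSum_partitions t z x y fun i j => by
    obtain ⟨h1, h2, h3, h4⟩ := hz i.divNat j.divNat
    unfold doubled
    split_ifs <;> assumption
  have h2 := hasSum_partitions t z x (fun j => (y j)⁻¹) fun i j => by
    obtain ⟨h1, h2, h3, h4⟩ := hz i.divNat j.divNat
    unfold doubled
    split_ifs <;> simp only [inv_inv] <;> assumption
  have hsum : Summable (fun lam : {lam : Fin n → ℕ // Antitone lam} =>
      z ^ (n + ∑ k, lam.1 k) * zeroPartFactor t lam.1 * bFactor t lam.1 *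
        hallLittlewoodBC t x lam.1 * hallLittlewoodBC t y lam.1) := by
    refine (h1.summable.mul_right
      ((∏ i, (x i - t * (x i)⁻¹))⁻¹ * (∏ i, (y i - t * (y i)⁻¹))⁻¹)).congr fun lam => ?_
    simp only [hallLittlewoodBC, div_eq_mul_inv]
    ring
  refine ⟨hsum, ?_⟩
  rw [ZUU_eq_sum_crossGrid, ← h2.tsum_eq, ← tsum_mul_left]
  refine tsum_congr fun lam => ?_
  have h3 := latticeElem_inv t n y (partState lam.1)
  have h4 : ((∏ i, ((y i)⁻¹ - t * y i)) * latticeElem t n y (partState lam.1)) /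
      (∏ i, (y i - t * (y i)⁻¹)) = latticeElem t n (fun i => (y i)⁻¹) (partState lam.1) := by
    rw [h3, mul_div_cancel_left₀ _ hY]
  have h5 : (∏ i, (x i - t * (x i)⁻¹)) * (latticeElem t n x (partState lam.1) /
      ∏ i, (x i - t * (x i)⁻¹)) = latticeElem t n x (partState lam.1) := mul_div_cancel₀ _ hX
  rw [← h4, Finset.prod_mul_distrib]
  simp only [hallLittlewoodBC]
  conv_rhs => rw [← h5]
  ring
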